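/- For $i=1,2$ let $G_i$ be a connected semisimple real algebraic group with a fixed Cartan involution, maximal compact subgroup $K_i$, maximal split subgroup $A_i=\exp\mathfrak a_i$, positive Weyl chamber, contracting horospherical subgroup $N_i$, $M_i=Z_{K_i}(A_i)$, minimal parabolic $P_i=M_iA_iN_i$, symmetric space $X_i=G_i/K_i$ and Furstenberg boundary $\mathcal F_i=G_i/P_i$. Let $G=G_1\times G_2$ with $K=K_1\times K_2$, $A=A_1\times A_2$, $N=N_1\times N_2$, $M=M_1\times M_2$, $P=P_1\times P_2$, so that $\mathfrak a=\mathfrak a_1\oplus\mathfrak a_2$, $X=X_1\times X_2$, $\mathcal F=G/P=\mathcal F_1\times\mathcal F_2$, and let $\pi_1:\mathfrak a\to\mathfrak a_1$ be the projection. For each of these groups the Iwasawa cocycle $H$ is given by $gk\in K\exp(H(g,\xi))N$ for $\xi=kP$, $k\in K$, and the Busemann map by $\beta_\xi(gK,hK)=H(g^{-1},\xi)-H(h^{-1},\xi)$. For a subgroup $\Delta$, a linear form $\psi\in\mathfrak a^*$ and a base point $o$ in the symmetric space, a $(\Delta,\psi)$-conformal measure with respect to $o$ is a Borel probability measure $\nu$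 on the Furstenberg boundary with $$\frac{dg_*\nu}{d\nu}(\eta)=e^{\psi(\beta_\eta(o,go))}\qquad\text{for all } g\in\Delta .$$ Let $\Gamma<G_1$ be a Zariski dense discrete subgroup with limit set $\Lambda\subset\mathcal F_1$: the set of all $\lim_n k_nP_1$ where $\gamma_n=k_n\exp(h_n)k_n'\in\Gamma$ are Cartan decompositions ($k_n,k_n'\in K_1$, $h_n\in\mathfrak a_1^+$) with $\alpha(h_n)\to\infty$ for every simple root $\alpha$. Let $\rho:\Gamma\to G_2$ be a discrete faithful Zariski dense representation and $\Gamma_\rho=\{(\gamma,\rho(\gamma)):\gamma\in\Gamma\}<G$. Let $f:\Lambda\to\mathcal F_2$ be a continuous $\rho$-equivariant map, $(\mathrm{id}\times f)(\xi)=(\xi,f(\xi))$, and $\Lambda_\rho=(\mathrm{id}\times f)(\Lambda)\subset\mathcal F$. Fix $o=(o_1,o_2)\in X$. 1. Let $\psi_1\in\mathfrak a_1^*$. If $\nu$ is a $(\Gamma,\psi_1)$-conformal measure on $\Lambda$ with respect to $o_1$, then $(\mathrm{id}\times f)_*\nu$ is a $(\Gamma_\rho,\psi_1\circ\pi_1)$-conformal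 measure with respect to $o$, and it is concentrated on $\Lambda_\rho$. 2. Let $\psi_1\in\mathfrak a_1^*$. Every $(\Gamma_\rho,\psi_1\circ\pi_1)$-conformal measure $\mu$ on $\Lambda_\rho$ with respect to $o$ is of the form $(\mathrm{id}\times f)_*\nu$ for some $(\Gamma,\psi_1)$-conformal measure $\nu$ on $\Lambda$ with respect to $o_1$; namely, $\nu$ is the image of $\mu$ under the projection $\mathcal F\to\mathcal F_1$. 3. Hence a measure $\mu$ on $\mathcal F$ is a $(\Gamma_\rho,\sigma)$-conformal measure on $\Lambda_\rho$ with respect to $o$ for some $\sigma\in\mathfrak a^*$ that factors through $\pi_1$ if and only if it is graph-conformal, that is, $\mu=(\mathrm{id}\times f)_*\nu$ for some $\psi_1\in\mathfrak a_1^*$ and some $(\Gamma,\psi_1)$-conformal measure $\nu$ on $\Lambda$ with respect to $o_1$. -/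

import Mathlib

open Filter Topology MeasureTheory

noncomputable section

namespace SelfJoining

/-! ### Groups with Iwasawa data, Furstenberg boundary, Busemann map, conformal measures -/

/-- The subgroups from which the Furstenberg boundary, the symmetric space and the Busemann map of
a semisimple group are built: `K`, `N`, the vector space `𝔞` and `exp : 𝔞 → G` (with image `A`).
This is only a container that lets the notions below be written once, for a semisimple group and
for a product of two of them. -/
structure Frame (G : Type*) [Group G] (𝔞 : Type*) [AddCommGroup 𝔞] where
  K : Subgroup G
  N : Subgroup G
  exp : Multiplicative 𝔞 →* G

namespace Frame

section Defs

variable {G : Type*} [Group G] {𝔞 : Type*} [AddCommGroup 𝔞]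

/-- The exponential of a vector of `𝔞`. -/
def e (S : Frame G 𝔞) (h : 𝔞) : G := S.exp (Multiplicative.ofAdd h)

/-- `A = exp 𝔞`. -/
def A (S : Frame G 𝔞) : Subgroup G := S.exp.range

/-- `M`, the centralizer of `A` in `K`. -/
def M (S : Frame G 𝔞) : Subgroup G := S.K ⊓ Subgroup.centralizer (S.A : Set G)

/-- `P = MAN`, as the subgroup generated by `M`, `A` and `N`. -/
def P (S : Frame G 𝔞) : Subgroup G := S.M ⊔ S.A ⊔ S.N

/-- The Furstenberg boundary `G / P`. -/
def Flag (S : Frame G 𝔞) : Type _ := G ⧸ S.P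

/-- The symmetric space `G / K`. -/
def Sym (S : Frame G 𝔞) : Type _ := G ⧸ S.K

instance (S : Frame G 𝔞) : MulAction G S.Flag := inferInstanceAs (MulAction G (G ⧸ S.P))

instance (S : Frame G 𝔞) : MulAction G S.Sym := inferInstanceAs (MulAction G (G ⧸ S.K))

/-- The quotient topology. -/
instance [TopologicalSpace G] (S : Frame G 𝔞) : TopologicalSpace S.Flag :=
  inferInstanceAs (TopologicalSpace (G ⧸ S.P))

/-- The Borel σ-algebra. -/
instance [TopologicalSpace G] (S : Frame G 𝔞) : MeasurableSpace S.Flag := borel _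

instance [TopologicalSpace G] (S : Frame G 𝔞) : BorelSpace S.Flag := ⟨rfl⟩

/-- The point `gP` of the Furstenberg boundary. -/
def flagMk (S : Frame G 𝔞) (g : G) : S.Flag := QuotientGroup.mk (s := S.P) g

/-- The point `gK` of the symmetric space. -/
def symMk (S : Frame G 𝔞) (g : G) : S.Sym := QuotientGroup.mk (s := S.K) g

/-- `h` is the logarithm of the `A`-component of `g k` in the `KAN` decomposition, where `k ∈ K`
represents `ξ`: that is, `ξ = kP` and `g k ∈ K exp(h) N`. -/
def IsIwasawa (S : Frame G 𝔞) (g : G) (ξ : S.Flag) (h : 𝔞) : Prop :=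
  ∃ k ∈ S.K, ξ = S.flagMk k ∧ ∃ k' ∈ S.K, ∃ n ∈ S.N, g * k = k' * S.e h * n

/-- The Iwasawa cocycle `H : G × 𝓕 → 𝔞`. -/
def iwasawa (S : Frame G 𝔞) (g : G) (ξ : S.Flag) : 𝔞 := Classical.epsilon (S.IsIwasawa g ξ)

theorem iwasawa_left (S : Frame G 𝔞) {k : G} (hk : k ∈ S.K) (g : G) (ξ : S.Flag) :
    S.iwasawa (k * g) ξ = S.iwasawa g ξ := by
  have : S.IsIwasawa (k * g) ξ = S.IsIwasawa g ξ := by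
    funext h
    apply propext
    constructor
    · rintro ⟨k₀, hk₀, hξ, k', hk', n, hn, he⟩
      refine ⟨k₀, hk₀, hξ, k⁻¹ * k', S.K.mul_mem (S.K.inv_mem hk) hk', n, hn, ?_⟩
      rw [mul_assoc, mul_assoc, ← mul_assoc k', ← he]
      group
    · rintro ⟨k₀, hk₀, hξ, k', hk', n, hn, he⟩
      refine ⟨k₀, hk₀, hξ, k * k', S.K.mul_mem hk hk', n, hn, ?_⟩
      rw [mul_assoc, he]
      group
  unfold iwasawa
  rw [this]

/-- `H(g⁻¹, ξ)` as a function of the point `gK` of the symmetric space. -/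
def iwasawaInv (S : Frame G 𝔞) (ξ : S.Flag) : S.Sym → 𝔞 :=
  Quotient.lift (s := QuotientGroup.leftRel S.K) (fun g => S.iwasawa g⁻¹ ξ) (by
    intro a b hab
    have hk : a⁻¹ * b ∈ S.K := QuotientGroup.leftRel_apply.mp hab
    have := S.iwasawa_left hk b⁻¹ ξ
    simpa using this)

/-- The Busemann map `β_ξ(gK, hK) = H(g⁻¹, ξ) - H(h⁻¹, ξ)`. -/
def busemann (S : Frame G 𝔞) (ξ : S.Flag) (x y : S.Sym) : 𝔞 :=
  S.iwasawaInv ξ x - S.iwasawaInv ξ y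

/-- `ν` is a `(Δ, ψ)`-conformal measure with respect to `o`: a Borel probability measure on the
Furstenberg boundary with `d(g_* ν)/dν (η) = exp (ψ (β_η(o, g o)))` for all `g ∈ Δ`. -/
structure IsConformal [TopologicalSpace G] [Module ℝ 𝔞] (S : Frame G 𝔞) (Δ : Subgroup G)
    (ψ : Module.Dual ℝ 𝔞) (o : S.Sym) (ν : Measure S.Flag) : Prop where
  prob : IsProbabilityMeasure ν
  map_eq : ∀ g ∈ Δ, ν.map (fun η => g • η) =
    ν.withDensity (fun η => ENNReal.ofReal (Real.exp (ψ (S.busemann η o (g • o)))))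

end Defs

section Prod

variable {G₁ G₂ : Type*} [Group G₁] [Group G₂] {𝔞₁ 𝔞₂ : Type*} [AddCommGroup 𝔞₁] [AddCommGroup 𝔞₂]

/-- The data of `G₁ × G₂`: `K = K₁ × K₂`, `N = N₁ × N₂`, `𝔞 = 𝔞₁ ⊕ 𝔞₂`, `A = A₁ × A₂`. -/
def prod (S₁ : Frame G₁ 𝔞₁) (S₂ : Frame G₂ 𝔞₂) : Frame (G₁ × G₂) (𝔞₁ × 𝔞₂) where
  K := S₁.K.prod S₂.K
  N := S₁.N.prod S₂.N
  exp :=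
    { toFun := fun h => (S₁.e h.toAdd.1, S₂.e h.toAdd.2)
      map_one' := by simp [e]
      map_mul' := by intro x y; simp [e] }

theorem inl_mem_P (S₁ : Frame G₁ 𝔞₁) (S₂ : Frame G₂ 𝔞₂) {p : G₁} (hp : p ∈ S₁.P) :
    ((p, 1) : G₁ × G₂) ∈ (S₁.prod S₂).P := by
  have : S₁.P ≤ (S₁.prod S₂).P.comap (MonoidHom.inl G₁ G₂) := by
    refine sup_le (sup_le ?_ ?_) ?_
    · rintro m ⟨hK, hc⟩
      refine (le_sup_left.trans le_sup_left : (S₁.prod S₂).M ≤ _) ⟨⟨hK, S₂.K.one_mem⟩, ?_⟩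
      rintro _ ⟨h, rfl⟩
      refine Prod.ext (hc (S₁.e h.toAdd.1) ⟨_, rfl⟩) ?_
      simp
    · rintro _ ⟨h, rfl⟩
      refine (le_sup_right.trans le_sup_left : (S₁.prod S₂).A ≤ _)
        ⟨Multiplicative.ofAdd (h.toAdd, 0), ?_⟩
      simp [prod, e]
    · intro n hn
      exact (le_sup_right : (S₁.prod S₂).N ≤ _) ⟨hn, S₂.N.one_mem⟩
  exact this hp

theorem inr_mem_P (S₁ : Frame G₁ 𝔞₁) (S₂ : Frame G₂ 𝔞₂) {p : G₂} (hp : p ∈ S₂.P) :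
    ((1, p) : G₁ × G₂) ∈ (S₁.prod S₂).P := by
  have : S₂.P ≤ (S₁.prod S₂).P.comap (MonoidHom.inr G₁ G₂) := by
    refine sup_le (sup_le ?_ ?_) ?_
    · rintro m ⟨hK, hc⟩
      refine (le_sup_left.trans le_sup_left : (S₁.prod S₂).M ≤ _) ⟨⟨S₁.K.one_mem, hK⟩, ?_⟩
      rintro _ ⟨h, rfl⟩
      refine Prod.ext ?_ (hc (S₂.e h.toAdd.2) ⟨_, rfl⟩)
      simp
    · rintro _ ⟨h, rfl⟩
      refine (le_sup_right.trans le_sup_left : (S₁.prod S₂).A ≤ _)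
        ⟨Multiplicative.ofAdd (0, h.toAdd), ?_⟩
      simp [prod, e]
    · intro n hn
      exact (le_sup_right : (S₁.prod S₂).N ≤ _) ⟨S₁.N.one_mem, hn⟩
  exact this hp

theorem fst_mem_P (S₁ : Frame G₁ 𝔞₁) (S₂ : Frame G₂ 𝔞₂) {p : G₁ × G₂}
    (hp : p ∈ (S₁.prod S₂).P) : p.1 ∈ S₁.P := by
  have : (S₁.prod S₂).P ≤ S₁.P.comap (MonoidHom.fst G₁ G₂) := by
    refine sup_le (sup_le ?_ ?_) ?_
    · rintro m ⟨hK, hc⟩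
      refine (le_sup_left.trans le_sup_left : S₁.M ≤ _) ⟨hK.1, ?_⟩
      rintro _ ⟨h, rfl⟩
      have := congrArg Prod.fst
        (hc ((S₁.prod S₂).e (h.toAdd, 0)) ⟨_, rfl⟩)
      simpa [prod, e] using this
    · rintro _ ⟨h, rfl⟩
      exact (le_sup_right.trans le_sup_left : S₁.A ≤ _) ⟨_, rfl⟩
    · intro n hn
      exact (le_sup_right : S₁.N ≤ _) hn.1
  exact this hp

/-- The identification `𝓕₁ × 𝓕₂ → 𝓕 = (G₁ × G₂) / P`, `(g₁P₁, g₂P₂) ↦ (g₁, g₂)P`. -/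
def flagPair (S₁ : Frame G₁ 𝔞₁) (S₂ : Frame G₂ 𝔞₂) :
    S₁.Flag → S₂.Flag → (S₁.prod S₂).Flag :=
  Quotient.lift₂ (s₁ := QuotientGroup.leftRel S₁.P) (s₂ := QuotientGroup.leftRel S₂.P)
    (fun g₁ g₂ => (S₁.prod S₂).flagMk (g₁, g₂)) (by
      intro a₁ a₂ b₁ b₂ h₁ h₂
      have h₁' : a₁⁻¹ * b₁ ∈ S₁.P := QuotientGroup.leftRel_apply.mp h₁
      have h₂' : a₂⁻¹ * b₂ ∈ S₂.P := QuotientGroup.leftRel_apply.mp h₂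
      refine QuotientGroup.eq.mpr ?_
      have := (S₁.prod S₂).P.mul_mem (inl_mem_P S₁ S₂ h₁') (inr_mem_P S₁ S₂ h₂')
      simpa using this)

/-- The projection `𝓕 → 𝓕₁`, `(g₁, g₂)P ↦ g₁P₁`. -/
def flagFst (S₁ : Frame G₁ 𝔞₁) (S₂ : Frame G₂ 𝔞₂) : (S₁.prod S₂).Flag → S₁.Flag :=
  Quotient.lift (s := QuotientGroup.leftRel (S₁.prod S₂).P) (fun g => S₁.flagMk g.1) (by
    intro a b h
    have h' : a⁻¹ * b ∈ (S₁.prod S₂).P := QuotientGroup.leftRel_apply.mp h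
    exact QuotientGroup.eq.mpr (fst_mem_P S₁ S₂ h'))

/-- The identification `X₁ × X₂ → X = (G₁ × G₂) / K`, `(g₁K₁, g₂K₂) ↦ (g₁, g₂)K`. -/
def symPair (S₁ : Frame G₁ 𝔞₁) (S₂ : Frame G₂ 𝔞₂) : S₁.Sym → S₂.Sym → (S₁.prod S₂).Sym :=
  Quotient.lift₂ (s₁ := QuotientGroup.leftRel S₁.K) (s₂ := QuotientGroup.leftRel S₂.K)
    (fun g₁ g₂ => (S₁.prod S₂).symMk (g₁, g₂)) (by
      intro a₁ a₂ b₁ b₂ h₁ h₂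
      have h₁' : a₁⁻¹ * b₁ ∈ S₁.K := QuotientGroup.leftRel_apply.mp h₁
      have h₂' : a₂⁻¹ * b₂ ∈ S₂.K := QuotientGroup.leftRel_apply.mp h₂
      exact QuotientGroup.eq.mpr ⟨h₁', h₂'⟩)

/-- The diagonal embedding `id × f : Λ → 𝓕`, `ξ ↦ (ξ, f ξ)`. -/
def graphMap (S₁ : Frame G₁ 𝔞₁) (S₂ : Frame G₂ 𝔞₂) {Λ : Set S₁.Flag} (f : Λ → S₂.Flag) (ξ : Λ) :
    (S₁.prod S₂).Flag :=
  flagPair S₁ S₂ ξ (f ξ)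

end Prod

end Frame

/-- The self-joining `Γ_ρ = {(γ, ρ γ) : γ ∈ Γ}`. -/
def selfJoining {G₁ G₂ : Type*} [Group G₁] [Group G₂] {Γ : Subgroup G₁} (ρ : Γ →* G₂) :
    Subgroup (G₁ × G₂) :=
  (Γ.subtype.prod ρ).range

/-! ### Connected semisimple real algebraic groups -/

section Semisimple

variable {V : Type*} [NormedAddCommGroup V] [InnerProductSpace ℝ V]

/-- Polynomial functions on `End V`: the algebra generated by the linear forms. -/
def polyFun (V : Type*) [NormedAddCommGroup V] [InnerProductSpace ℝ V] :
    Subalgebra ℝ ((V →L[ℝ] V) → ℝ) :=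
  Algebra.adjoin ℝ {φ | ∃ l : (V →L[ℝ] V) →ₗ[ℝ] ℝ, φ = l}

/-- Zariski closed subsets of `GL(V)`. -/
def IsZariskiClosed (H : Set (V →L[ℝ] V)ˣ) : Prop :=
  ∃ I : Set ((V →L[ℝ] V) → ℝ), I ⊆ polyFun V ∧
    H = {g : (V →L[ℝ] V)ˣ | ∀ p ∈ I, p (g : V →L[ℝ] V) = 0}

/-- Symmetric endomorphisms. -/
def IsSymm (X : V →L[ℝ] V) : Prop := ∀ v w : V, inner ℝ (X v) w = inner ℝ v (X w)

/-- `exp X` as an element of `GL(V)`. -/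
def expUnit [FiniteDimensional ℝ V] (X : V →L[ℝ] V) : (V →L[ℝ] V)ˣ where
  val := NormedSpace.exp X
  inv := NormedSpace.exp (-X)
  val_inv := by
    have := FiniteDimensional.complete ℝ V
    let _ : NormedAlgebra ℚ (V →L[ℝ] V) := NormedAlgebra.restrictScalars ℚ ℝ _
    rw [← NormedSpace.exp_add_of_commute (Commute.refl X).neg_right]
    simp
  inv_val := by
    have := FiniteDimensional.complete ℝ V
    let _ : NormedAlgebra ℚ (V →L[ℝ] V) := NormedAlgebra.restrictScalars ℚ ℝ _
    rw [← NormedSpace.exp_add_of_commute (Commute.refl X).neg_left]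
    simp

-- the commutator bracket on `End V`
attribute [local instance] LieRing.ofAssociativeRing

/-- A connected semisimple real algebraic group `G ≤ GL(V)`, together with a Cartan involution, a
maximal abelian subspace `𝔞` of `𝔭` and a positive Weyl chamber.

`G` is the identity component of a Zariski closed subgroup of `GL(V)` and has semisimple Lie
algebra. The Cartan involution `θ` is recorded by the inner product of `V`: `G` is stable under
adjoints, and `θ X = - X*` on the Lie algebra. Conversely, for every Cartan involution `θ` of a
semisimple real algebraic group `G ≤ GL(V)` there is an inner product on `V` for which `θ` has this
form. The Weyl chamber is recorded by a regular element `chamber` in its interior. -/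
structure SemisimpleGroup (V : Type*) [NormedAddCommGroup V] [InnerProductSpace ℝ V]
    [FiniteDimensional ℝ V] where
  G : Subgroup (V →L[ℝ] V)ˣ
  /-- `G` is the identity component of a real algebraic group -/
  algebraic : ∃ H : Subgroup (V →L[ℝ] V)ˣ, IsZariskiClosed (H : Set (V →L[ℝ] V)ˣ) ∧
    (G : Set (V →L[ℝ] V)ˣ) = connectedComponentIn (H : Set (V →L[ℝ] V)ˣ) 1
  /-- the Lie algebra of `G` -/
  lie : LieSubalgebra ℝ (V →L[ℝ] V)
  mem_lie : ∀ X : V →L[ℝ] V, X ∈ lie ↔ ∀ t : ℝ, expUnit (t • X) ∈ G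
  semisimple : LieAlgebra.IsSemisimple ℝ lie
  adjoint_mem : ∀ g ∈ G, ∃ g' ∈ G, ∀ v w : V,
    inner ℝ ((g : V →L[ℝ] V) v) w = inner ℝ v ((g' : V →L[ℝ] V) w)
  /-- a maximal abelian subspace of `𝔭 = {X ∈ lie : X* = X}` -/
  𝔞 : Submodule ℝ (V →L[ℝ] V)
  𝔞_lie : ∀ X ∈ 𝔞, X ∈ lie
  𝔞_symm : ∀ X ∈ 𝔞, IsSymm X
  𝔞_comm : ∀ X ∈ 𝔞, ∀ Y ∈ 𝔞, X * Y = Y * X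
  𝔞_max : ∀ X ∈ lie, IsSymm X → (∀ Y ∈ 𝔞, X * Y = Y * X) → X ∈ 𝔞
  chamber : 𝔞
  /-- no restricted root vanishes at `chamber` -/
  regular : ∀ α : Module.Dual ℝ 𝔞, α ≠ 0 →
    (∃ X ∈ lie, X ≠ 0 ∧ ∀ h : 𝔞, ⁅(h : V →L[ℝ] V), X⁆ = α h • X) → α chamber ≠ 0

namespace SemisimpleGroup

variable [FiniteDimensional ℝ V]

/-- Restricted roots of the Lie algebra with respect to `𝔞`. -/
def IsRoot (S : SemisimpleGroup V) (α : Module.Dual ℝ S.𝔞) : Prop :=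
  α ≠ 0 ∧ ∃ X ∈ S.lie, X ≠ 0 ∧ ∀ h : S.𝔞, ⁅(h : V →L[ℝ] V), X⁆ = α h • X

/-- Positive roots. -/
def IsPosRoot (S : SemisimpleGroup V) (α : Module.Dual ℝ S.𝔞) : Prop :=
  S.IsRoot α ∧ 0 < α S.chamber

/-- Simple roots: positive roots that are not a sum of two positive roots. -/
def IsSimpleRoot (S : SemisimpleGroup V) (α : Module.Dual ℝ S.𝔞) : Prop :=
  S.IsPosRoot α ∧ ∀ β γ : Module.Dual ℝ S.𝔞, S.IsPosRoot β → S.IsPosRoot γ → α ≠ β + γ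

/-- The closed positive Weyl chamber `𝔞⁺`. -/
def closedChamber (S : SemisimpleGroup V) : Set S.𝔞 :=
  {h | ∀ α, S.IsPosRoot α → 0 ≤ α h}

/-- `exp : 𝔞 → G`. -/
def exp𝔞 (S : SemisimpleGroup V) : Multiplicative S.𝔞 →* S.G where
  toFun h := ⟨expUnit (h.toAdd : V →L[ℝ] V), by
    have := (S.mem_lie _).1 (S.𝔞_lie _ h.toAdd.2) 1
    simpa using this⟩
  map_one' := by
    apply Subtype.ext
    apply Units.ext
    simp [expUnit]
  map_mul' x y := by
    have := FiniteDimensional.complete ℝ V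
    let _ : NormedAlgebra ℚ (V →L[ℝ] V) := NormedAlgebra.restrictScalars ℚ ℝ _
    apply Subtype.ext
    apply Units.ext
    have hc : Commute (x.toAdd : V →L[ℝ] V) (y.toAdd : V →L[ℝ] V) :=
      S.𝔞_comm _ x.toAdd.2 _ y.toAdd.2
    simpa [expUnit] using NormedSpace.exp_add_of_commute hc

/-- The maximal compact subgroup `K`: the elements of `G` that preserve the inner product. -/
def K (S : SemisimpleGroup V) : Subgroup S.G where
  carrier := {g | ∀ v : V, ‖((g : (V →L[ℝ] V)ˣ) : V →L[ℝ] V) v‖ = ‖v‖}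
  one_mem' v := by simp
  mul_mem' {a b} ha hb v := by
    have h1 := ha (((b : (V →L[ℝ] V)ˣ) : V →L[ℝ] V) v)
    simpa [hb v] using h1
  inv_mem' {a} ha v := by
    have h1 := ha ((((a : (V →L[ℝ] V)ˣ)⁻¹ : (V →L[ℝ] V)ˣ) : V →L[ℝ] V) v)
    rw [← mul_apply_eq_comp, Units.mul_inv] at h1
    simpa using h1.symm

/-- `N = {g ∈ G : a⁻ⁿ g aⁿ → 1}`, where `a = exp chamber` lies in the interior of `A⁺`. -/
def N (S : SemisimpleGroup V) : Subgroup S.G where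
  carrier := {g | Tendsto (fun n : ℕ => (S.exp𝔞 (Multiplicative.ofAdd S.chamber) ^ n)⁻¹ * g *
    S.exp𝔞 (Multiplicative.ofAdd S.chamber) ^ n) atTop (𝓝 1)}
  one_mem' := by simp
  mul_mem' {a b} ha hb := by
    have := Filter.Tendsto.mul ha hb
    rw [mul_one] at this
    refine this.congr fun n => ?_
    group
  inv_mem' {a} ha := by
    have := Filter.Tendsto.inv ha
    rw [inv_one] at this
    refine this.congr fun n => ?_
    group

/-- The data `K`, `N`, `exp : 𝔞 → G` of a semisimple group. -/
def frame (S : SemisimpleGroup V) : Frame S.G S.𝔞 where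
  K := S.K
  N := S.N
  exp := S.exp𝔞

/-- Zariski density of a subgroup of `G`. -/
def IsZariskiDense (S : SemisimpleGroup V) (Δ : Subgroup S.G) : Prop :=
  ∀ p ∈ polyFun V, (∀ g ∈ Δ, p ((g : (V →L[ℝ] V)ˣ) : V →L[ℝ] V) = 0) →
    ∀ g : S.G, p ((g : (V →L[ℝ] V)ˣ) : V →L[ℝ] V) = 0

/-- The sequence `g` of `G` converges to `ξ`: there are Cartan decompositions
`g_n = k_n exp(h_n) k'_n`, `h_n ∈ 𝔞⁺`, with `α(h_n) → ∞` for every simple root `α` and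
`k_n P → ξ`. -/
def ConvergesTo (S : SemisimpleGroup V) (g : ℕ → S.G) (ξ : S.frame.Flag) : Prop :=
  ∃ (k k' : ℕ → S.G) (h : ℕ → S.𝔞),
    (∀ n, k n ∈ S.K ∧ k' n ∈ S.K ∧ h n ∈ S.closedChamber ∧
      g n = k n * S.frame.e (h n) * k' n) ∧
    (∀ α, S.IsSimpleRoot α → Tendsto (fun n => α (h n)) atTop atTop) ∧
    Tendsto (fun n => S.frame.flagMk (k n)) atTop (𝓝 ξ)

/-- The limit set of a subgroup of `G`. -/
def limitSet (S : SemisimpleGroup V) (Δ : Subgroup S.G) : Set S.frame.Flag :=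
  {ξ | ∃ g : ℕ → S.G, (∀ n, g n ∈ Δ) ∧ S.ConvergesTo g ξ}

end SemisimpleGroup

end Semisimple

end SelfJoining

end

open scoped ENNReal

noncomputable section

namespace SelfJoining

/-! ### Exponentials of symmetric endomorphisms -/

section LinearAlgebra

variable {V : Type*} [NormedAddCommGroup V] [InnerProductSpace ℝ V]

/-! The first projection of flags undoes `id × f` on `Λ` and is equivariant for `(γ, ρ γ) ↦ γ`. The
first component of the Busemann map of `G₁ × G₂` is the Busemann map of `G₁` at the projected flag.
So for a linear form that factors through `𝔞₁` the density on the graph is the pullback of the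
density on `Λ`, and the conformality equation can be carried both ways along the embedding
(`map_graph_eq_withDensity`, `map_val_eq_withDensity`). A measure concentrated on the graph is the
pushforward of its own pullback to `Λ`, which gives the converse statements.

Two structural inputs make this rigorous. The cocycle is an arbitrary choice among admissible `h`,
so the projection formula requires existence of Iwasawa decompositions in both factors and
uniqueness in the first (`exists_isIwasawa`, `isIwasawa_unique`). To move measures, `id × f` has to
be a measurable embedding; this follows from closedness of `P₁`, `P₂` and of the limit set
(`isClosed_P`, `isClosed_limitSet`).

Both inputs come from the dynamics of conjugation by `a = exp chamber`. In an eigenbasis of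
`chamber`, conjugation by `aⁿ` rescales matrix entries exponentially: the conjugates of an element
converge exactly when it is block upper triangular, and the limit is its block diagonal part. For `g
= k exp(h) n` the conjugates of `k⁻¹g` therefore recover `exp h`. The algebraic hypothesis puts the
logarithm of the polar part of each element into the Lie algebra, and regularity of `chamber` forces
symmetric elements of the Lie algebra that commute with it into `𝔞`. -/

theorem exp_apply_of_apply_eq_smul [FiniteDimensional ℝ V] {X : V →L[ℝ] V} {v : V} {c : ℝ}
    (h : X v = c • v) : NormedSpace.exp X v = Real.exp c • v := by
  have := FiniteDimensional.complete ℝ V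
  have hpow : ∀ n : ℕ, (X ^ n) v = c ^ n • v := by
    intro n
    induction n with
    | zero => simp
    | succ n ih => rw [pow_succ, mul_apply_eq_comp, h, map_smul, ih, smul_smul, pow_succ']
  have h1 := NormedSpace.exp_series_hasSum_exp' (𝕂 := ℝ) X
  have h2 := (ContinuousLinearMap.apply ℝ V v).hasSum h1
  have h3 := (NormedSpace.exp_series_hasSum_exp' (𝕂 := ℝ) c).smul_const v
  rw [← Real.exp_eq_exp_ℝ] at h3
  refine h2.unique ?_
  convert h3 using 2 with n
  simp [hpow, smul_smul]

theorem IsSymm.exists_eigenbasis [FiniteDimensional ℝ V] {X : V →L[ℝ] V} (hX : IsSymm X) :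
    ∃ (b : OrthonormalBasis (Fin (Module.finrank ℝ V)) ℝ V) (l : Fin (Module.finrank ℝ V) → ℝ),
      ∀ i, X (b i) = l i • b i := by
  have h : (X : V →ₗ[ℝ] V).IsSymmetric := hX
  exact ⟨h.eigenvectorBasis rfl, h.eigenvalues rfl, fun i => h.apply_eigenvectorBasis rfl i⟩

variable {ι : Type*} [Fintype ι]

theorem ext_inner_orthonormalBasis (b : OrthonormalBasis ι ℝ V) {v w : V}
    (h : ∀ i, (inner ℝ (b i) v : ℝ) = inner ℝ (b i) w) : v = w := by
  refine b.repr.injective ?_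
  ext i
  simpa [b.repr_apply_apply] using h i

theorem ext_orthonormalBasis (b : OrthonormalBasis ι ℝ V) {S T : V →L[ℝ] V}
    (h : ∀ i j, inner ℝ (b i) (S (b j)) = inner ℝ (b i) (T (b j))) : S = T := by
  have h' : (S : V →ₗ[ℝ] V) = T := by
    refine b.toBasis.ext fun j => ?_
    refine ext_inner_orthonormalBasis b fun i => ?_
    simpa using h i j
  exact ContinuousLinearMap.coe_injective h'

/-- Taking matrix entries is an injective linear map on a finite-dimensional space, hence a closed
embedding. -/
theorem tendsto_iff_inner_orthonormalBasis [FiniteDimensional ℝ V] (b : OrthonormalBasis ι ℝ V)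
    {α : Type*} {F : Filter α} {T : α → V →L[ℝ] V} {S : V →L[ℝ] V} :
    Tendsto T F (𝓝 S) ↔ ∀ i j, Tendsto (fun n => (inner ℝ (b i) (T n (b j)) : ℝ)) F
      (𝓝 (inner ℝ (b i) (S (b j)))) := by
  let φ : (V →L[ℝ] V) →ₗ[ℝ] (ι → ι → ℝ) :=
    { toFun := fun T i j => inner ℝ (b i) (T (b j))
      map_add' := by intros; ext; simp [inner_add_right]
      map_smul' := by intros; ext; simp [inner_smul_right] }
  have hφ : Topology.IsClosedEmbedding φ := by
    refine LinearMap.isClosedEmbedding_of_injective (LinearMap.ker_eq_bot.2 fun S T h => ?_)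
    exact ext_orthonormalBasis b fun i j => congrFun (congrFun h i) j
  rw [hφ.isInducing.tendsto_nhds_iff, tendsto_pi_nhds]
  simp_rw [tendsto_pi_nhds]
  rfl

/-- The endomorphism with matrix `c` in an orthonormal basis. -/
def ofEntries (b : OrthonormalBasis ι ℝ V) (c : ι → ι → ℝ) : V →L[ℝ] V :=
  ∑ i, ∑ j, c i j • (innerSL ℝ (b j)).smulRight (b i)

theorem inner_ofEntries (b : OrthonormalBasis ι ℝ V) (c : ι → ι → ℝ) (i j : ι) :
    inner ℝ (b i) (ofEntries b c (b j)) = c i j := by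
  classical
  simp [ofEntries, inner_sum, inner_smul_right,
    orthonormal_iff_ite.1 b.orthonormal, Finset.sum_ite_eq]

variable {b : OrthonormalBasis ι ℝ V} {l : ι → ℝ} {X : V →L[ℝ] V}

theorem IsSymm.inner_apply_eigen (hX : IsSymm X) (hb : ∀ i, X (b i) = l i • b i) (i : ι) (v : V) :
    inner ℝ (b i) (X v) = l i * inner ℝ (b i) v := by
  rw [← hX, hb, real_inner_smul_left]

theorem isSymm_of_eigenbasis (hb : ∀ i, X (b i) = l i • b i) : IsSymm X := by
  classical
  intro v w
  have hX : ∀ v, X v = ∑ i, (inner ℝ (b i) v * l i) • b i := by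
    intro v
    conv_lhs => rw [← b.sum_repr' v, map_sum]
    simp [hb, smul_smul]
  rw [hX v, hX w, sum_inner, inner_sum]
  refine Finset.sum_congr rfl fun i _ => ?_
  rw [real_inner_smul_left, real_inner_smul_right, real_inner_comm (b i) v]
  ring

theorem eigen_smul (hb : ∀ i, X (b i) = l i • b i) (t : ℝ) (i : ι) :
    (t • X) (b i) = (t * l i) • b i := by
  simp [hb, smul_smul]

theorem IsSymm.smul (hX : IsSymm X) (t : ℝ) : IsSymm (t • X) := by
  intro v w
  simp [real_inner_smul_left, real_inner_smul_right, hX v w]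

variable [FiniteDimensional ℝ V]

theorem IsSymm.exp (hX : IsSymm X) : IsSymm (NormedSpace.exp X) := by
  obtain ⟨b, l, hb⟩ := hX.exists_eigenbasis
  exact isSymm_of_eigenbasis fun i => exp_apply_of_apply_eq_smul (hb i)

theorem expUnit_val (X : V →L[ℝ] V) : (expUnit X : V →L[ℝ] V) = NormedSpace.exp X := rfl

theorem expUnit_inv (X : V →L[ℝ] V) : (expUnit X)⁻¹ = expUnit (-X) := by
  apply Units.ext
  rfl

theorem expUnit_add {X Y : V →L[ℝ] V} (h : Commute X Y) :
    expUnit (X + Y) = expUnit X * expUnit Y := by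
  have := FiniteDimensional.complete ℝ V
  let _ : NormedAlgebra ℚ (V →L[ℝ] V) := NormedAlgebra.restrictScalars ℚ ℝ _
  exact Units.ext (NormedSpace.exp_add_of_commute h)

/-- An endomorphism that commutes with `exp X`, `X` symmetric, commutes with `X`. -/
theorem IsSymm.commute_of_commute_exp (hX : IsSymm X) {T : V →L[ℝ] V}
    (h : T * NormedSpace.exp X = NormedSpace.exp X * T) : T * X = X * T := by
  obtain ⟨b, l, hb⟩ := hX.exists_eigenbasis
  refine ext_orthonormalBasis b fun i j => ?_
  have he := fun i => exp_apply_of_apply_eq_smul (hb i)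
  have h1 := congrArg (fun S : V →L[ℝ] V => (inner ℝ (b i) (S (b j)) : ℝ)) h
  simp only [mul_apply_eq_comp] at h1 ⊢
  rw [he, map_smul, real_inner_smul_right, hX.exp.inner_apply_eigen he] at h1
  rw [hb, map_smul, real_inner_smul_right, hX.inner_apply_eigen hb]
  -- An entry of `T` can be nonzero only where the two eigenvalues of `exp X` agree; injectivity of
  -- the real exponential then makes those of `X` agree.
  have h2 : (Real.exp (l j) - Real.exp (l i)) * inner ℝ (b i) (T (b j)) = 0 := by linarith
  rcases mul_eq_zero.1 h2 with h3 | h3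
  · rw [Real.exp_injective (sub_eq_zero.1 h3)]
  · simp [h3]

theorem IsSymm.eq_zero_of_exp_eq_one (hX : IsSymm X) (h : NormedSpace.exp X = 1) : X = 0 := by
  obtain ⟨b, l, hb⟩ := hX.exists_eigenbasis
  refine ext_orthonormalBasis b fun i j => ?_
  have h1 := exp_apply_of_apply_eq_smul (hb j)
  have h2 : (Real.exp (l j) - 1) • b j = 0 := by
    rw [sub_smul, ← h1, h]
    simp
  have h3 : b j ≠ 0 := b.orthonormal.ne_zero j
  have h4 : l j = 0 := by
    have := (smul_eq_zero.1 h2).resolve_right h3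
    rwa [sub_eq_zero, Real.exp_eq_one_iff] at this
  simp [hb, h4]

/-- A symmetric endomorphism is bounded in terms of `exp (± X)`. -/
theorem IsSymm.norm_le_log (hX : IsSymm X) {C : ℝ} (hC : 1 ≤ C)
    (h1 : ‖NormedSpace.exp X‖ ≤ C) (h2 : ‖NormedSpace.exp (-X)‖ ≤ C) : ‖X‖ ≤ Real.log C := by
  obtain ⟨b, l, hb⟩ := hX.exists_eigenbasis
  have hC0 : 0 < C := by linarith
  -- Testing the norm bounds on a unit eigenvector gives `exp (± l i) ≤ C`.
  have key : ∀ i, |l i| ≤ Real.log C := by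
    intro i
    have hb' : (-X) (b i) = (- l i) • b i := by simp [hb]
    have e1 := exp_apply_of_apply_eq_smul (hb i)
    have e2 := exp_apply_of_apply_eq_smul hb'
    have n1 := (NormedSpace.exp X).le_opNorm (b i)
    have n2 := (NormedSpace.exp (-X)).le_opNorm (b i)
    rw [e1, norm_smul, b.orthonormal.1 i, mul_one, mul_one, Real.norm_eq_abs, Real.abs_exp] at n1
    rw [e2, norm_smul, b.orthonormal.1 i, mul_one, mul_one, Real.norm_eq_abs, Real.abs_exp] at n2
    rw [abs_le]
    constructor
    · have := (Real.le_log_iff_exp_le hC0).2 (n2.trans h2)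
      linarith
    · exact (Real.le_log_iff_exp_le hC0).2 (n1.trans h1)
  have hL : 0 ≤ Real.log C := Real.log_nonneg hC
  refine ContinuousLinearMap.opNorm_le_bound _ hL fun v => ?_
  refine abs_le_of_sq_le_sq' ?_ (by positivity) |>.2
  rw [mul_pow, ← b.sum_sq_norm_inner_right (X v), ← b.sum_sq_norm_inner_right v, Finset.mul_sum]
  refine Finset.sum_le_sum fun i _ => ?_
  rw [hX.inner_apply_eigen hb, norm_mul, mul_pow]
  gcongr
  exact key i

/-- The logarithm is taken eigenvalue by eigenvalue, which positivity allows. -/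
theorem exists_symm_exp_eq {q : V →L[ℝ] V} (hq : IsSymm q)
    (hpos : ∀ v, v ≠ 0 → 0 < inner ℝ (q v) v) :
    ∃ Z : V →L[ℝ] V, IsSymm Z ∧ NormedSpace.exp Z = q := by
  classical
  obtain ⟨b, l, hb⟩ := hq.exists_eigenbasis
  have hl : ∀ i, 0 < l i := by
    intro i
    have := hpos (b i) (b.orthonormal.ne_zero i)
    rw [hb, real_inner_smul_left, real_inner_self_eq_norm_sq, b.orthonormal.1 i] at this
    simpa using this
  let Z := ofEntries b fun i j => if i = j then Real.log (l i) else 0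
  have hZ : ∀ i, Z (b i) = Real.log (l i) • b i := by
    intro i
    refine ext_inner_orthonormalBasis b fun j => ?_
    rw [inner_ofEntries, real_inner_smul_right,
      orthonormal_iff_ite.1 b.orthonormal]
    split_ifs with h <;> simp [h]
  refine ⟨Z, isSymm_of_eigenbasis hZ, ext_orthonormalBasis b fun i j => ?_⟩
  rw [exp_apply_of_apply_eq_smul (hZ j), Real.exp_log (hl j), hb]

/-! ### Conjugation by `exp (t X)` -/

/-- `exp (-tX) T exp (tX)`. -/
def conjExp (X : V →L[ℝ] V) (t : ℝ) (T : V →L[ℝ] V) : V →L[ℝ] V :=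
  NormedSpace.exp (-(t • X)) * T * NormedSpace.exp (t • X)

/-- The block diagonal part of `T`, for the blocks on which `l` is constant. -/
def blockDiag (b : OrthonormalBasis ι ℝ V) (l : ι → ℝ) (T : V →L[ℝ] V) : V →L[ℝ] V :=
  ofEntries b fun i j => if l i = l j then inner ℝ (b i) (T (b j)) else 0

/-- `T` is block upper triangular. -/
def IsUpper (b : OrthonormalBasis ι ℝ V) (l : ι → ℝ) (T : V →L[ℝ] V) : Prop :=
  ∀ i j, l i < l j → inner ℝ (b i) (T (b j)) = 0

theorem inner_conjExp (hb : ∀ i, X (b i) = l i • b i) (t : ℝ) (T : V →L[ℝ] V)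
    (i j : ι) : inner ℝ (b i) (conjExp X t T (b j)) =
      Real.exp (t * (l j - l i)) * inner ℝ (b i) (T (b j)) := by
  have h1 := fun i => exp_apply_of_apply_eq_smul (eigen_smul hb t i)
  have h2 := fun i => exp_apply_of_apply_eq_smul (eigen_smul hb (-t) i)
  rw [neg_smul] at h2
  have hs : IsSymm (NormedSpace.exp (-(t • X))) := isSymm_of_eigenbasis h2
  simp only [conjExp, mul_apply_eq_comp]
  rw [h1, map_smul, map_smul, real_inner_smul_right, hs.inner_apply_eigen h2, ← mul_assoc,
    ← Real.exp_add]
  ring_nf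

theorem det_conjExp (X : V →L[ℝ] V) (t : ℝ) (T : V →L[ℝ] V) : (conjExp X t T).det = T.det := by
  have h : ∀ A B : V →L[ℝ] V, (A * B).det = A.det * B.det := fun A B =>
    LinearMap.det_comp (A : V →ₗ[ℝ] V) (B : V →ₗ[ℝ] V)
  have h1 : (NormedSpace.exp (t • X)).det * (NormedSpace.exp (-(t • X))).det = 1 := by
    rw [← h]
    have := (expUnit (t • X)).mul_inv
    rw [expUnit_inv, expUnit_val, expUnit_val] at this
    rw [this]
    exact LinearMap.det_id
  rw [conjExp, h, h]
  linear_combination T.det * h1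

/-- Entries below the blocks decay exponentially, those inside the blocks are fixed, and those
above, which would explode, vanish by hypothesis. -/
theorem conjExp_tendsto (hb : ∀ i, X (b i) = l i • b i) {T : V →L[ℝ] V}
    (hT : IsUpper b l T) :
    Tendsto (fun n : ℕ => conjExp X n T) atTop (𝓝 (blockDiag b l T)) := by
  rw [tendsto_iff_inner_orthonormalBasis b]
  intro i j
  simp_rw [inner_conjExp hb, blockDiag, inner_ofEntries]
  rcases lt_trichotomy (l i) (l j) with h | h | h
  · simp [hT i j h]
  · simp [h]
  · rw [if_neg h.ne']
    have h1 : Tendsto (fun n : ℕ => (n : ℝ) * (l j - l i)) atTop atBot :=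
      tendsto_natCast_atTop_atTop.atTop_mul_const_of_neg (by linarith)
    simpa using (Real.tendsto_exp_atBot.comp h1).mul_const (inner ℝ (b i) (T (b j)))

/-- If `T n → T` and the conjugates of `T n` converge, then `T` is block upper triangular. -/
theorem isUpper_of_tendsto (hb : ∀ i, X (b i) = l i • b i)
    {T : ℕ → V →L[ℝ] V} {T' L : V →L[ℝ] V} {u : ℕ → ℕ} (hu : Tendsto u atTop atTop)
    (hT : Tendsto T atTop (𝓝 T'))
    (hL : Tendsto (fun n : ℕ => conjExp X (u n) (T n)) atTop (𝓝 L)) : IsUpper b l T' := by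
  rw [tendsto_iff_inner_orthonormalBasis b] at hT hL
  intro i j hij
  -- Undoing the conjugation multiplies a convergent entry by a factor tending to `0`.
  have h1 : Tendsto (fun n : ℕ => -((u n : ℝ) * (l j - l i))) atTop atBot :=
    tendsto_neg_atTop_atBot.comp ((tendsto_natCast_atTop_atTop.comp hu).atTop_mul_const
      (by linarith))
  have h2 := (Real.tendsto_exp_atBot.comp h1).mul (hL i j)
  simp_rw [inner_conjExp hb, Function.comp_apply, ← mul_assoc, ← Real.exp_add] at h2
  simp only [neg_add_cancel, Real.exp_zero, one_mul, zero_mul] at h2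
  exact tendsto_nhds_unique (hT i j) h2

theorem isUpper_of_conjExp_tendsto (hb : ∀ i, X (b i) = l i • b i)
    {T L : V →L[ℝ] V} (hL : Tendsto (fun n : ℕ => conjExp X n T) atTop (𝓝 L)) :
    IsUpper b l T ∧ L = blockDiag b l T := by
  have h := isUpper_of_tendsto hb tendsto_id tendsto_const_nhds hL
  exact ⟨h, tendsto_nhds_unique hL (conjExp_tendsto hb h)⟩

theorem IsUpper.of_tendsto {T : ℕ → V →L[ℝ] V} {L : V →L[ℝ] V} (hL : Tendsto T atTop (𝓝 L))
    (h : ∀ n, IsUpper b l (T n)) : IsUpper b l L := by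
  rw [tendsto_iff_inner_orthonormalBasis b] at hL
  intro i j hij
  refine tendsto_nhds_unique (hL i j) ?_
  simp [h _ i j hij]

theorem blockDiag_tendsto {T : ℕ → V →L[ℝ] V} {L : V →L[ℝ] V} (hL : Tendsto T atTop (𝓝 L)) :
    Tendsto (fun n => blockDiag b l (T n)) atTop (𝓝 (blockDiag b l L)) := by
  rw [tendsto_iff_inner_orthonormalBasis b] at hL ⊢
  intro i j
  simp_rw [blockDiag, inner_ofEntries]
  split_ifs
  · exact hL i j
  · simp

/-- The block diagonal part is a limit of conjugates of `T`, and the determinant is continuous and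
invariant under conjugation. Invertibility thus survives in the limit. -/
theorem det_blockDiag (hb : ∀ i, X (b i) = l i • b i) {T : V →L[ℝ] V}
    (hT : IsUpper b l T) : (blockDiag b l T).det = T.det := by
  have h1 := (ContinuousLinearMap.continuous_det.tendsto _).comp (conjExp_tendsto hb hT)
  refine tendsto_nhds_unique h1 ?_
  simp [Function.comp_def, det_conjExp]

/-- If conjugation by `exp (nX)` and by `exp (-nX)` both keep `T` bounded, then `T` commutes
with `exp (tX)`. -/
theorem conjExp_eq_self (hX : IsSymm X) {T L L' : V →L[ℝ] V}
    (h1 : Tendsto (fun n : ℕ => conjExp X n T) atTop (𝓝 L))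
    (h2 : Tendsto (fun n : ℕ => conjExp X (-n) T) atTop (𝓝 L')) (t : ℝ) : conjExp X t T = T := by
  obtain ⟨b, l, hb⟩ := hX.exists_eigenbasis
  have hb' : ∀ i, (-X) (b i) = (-l i) • b i := by simp [hb]
  have hc : ∀ n : ℕ, conjExp (-X) n T = conjExp X (-n) T := by simp [conjExp]
  simp_rw [← hc] at h2
  -- Reversing the sign of `X` reverses the order of the eigenvalues, so `T` is both upper and lower
  -- block triangular.
  have u1 := (isUpper_of_conjExp_tendsto hb h1).1
  have u2 := (isUpper_of_conjExp_tendsto (l := fun i => -l i) hb' h2).1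
  refine ext_orthonormalBasis b fun i j => ?_
  rw [inner_conjExp hb]
  rcases lt_trichotomy (l i) (l j) with h | h | h
  · simp [u1 i j h]
  · simp [h]
  · simp [u2 i j (by simpa using h)]

end LinearAlgebra

/-! ### Zariski closed subgroups and the polar decomposition -/

section Polynomial

variable {V : Type*} [NormedAddCommGroup V] [InnerProductSpace ℝ V] [FiniteDimensional ℝ V]

/-- The exponential functions on `ℝ`, multiplicatively indexed by their exponents. -/
def expFun : Multiplicative ℝ →* (ℝ → ℝ) where
  toFun c t := Real.exp (c.toAdd * t)
  map_one' := by ext; simp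
  map_mul' x y := by ext; simp [add_mul, Real.exp_add]

/-- A linear combination of exponential functions that vanishes on `ℕ` is zero. -/
theorem eq_zero_of_mem_span_expFun {f : ℝ → ℝ} (hf : f ∈ Submodule.span ℝ (Set.range expFun))
    (h : ∀ n : ℕ, f n = 0) : f = 0 := by
  obtain ⟨c, rfl⟩ := Finsupp.mem_span_range_iff_exists_finsupp.1 hf
  let φ : Multiplicative ℝ → (Multiplicative ℕ →* ℝ) := fun a =>
    { toFun := fun n => expFun a (n.toAdd : ℝ)
      map_one' := by simp [expFun]
      map_mul' := by intro x y; simp [expFun, mul_add, Real.exp_add] }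
  -- Distinct exponents give distinct characters of `ℕ`, already at `1`; Dedekind independence of
  -- characters then applies.
  have hφ : Function.Injective φ := by
    intro a a' haa
    have := DFunLike.congr_fun haa (Multiplicative.ofAdd 1)
    simpa [φ, expFun] using this
  have hli := (linearIndependent_monoidHom (Multiplicative ℕ) ℝ).comp φ hφ
  have hc : c = 0 := by
    refine linearIndependent_iff.1 hli c ?_
    ext n
    have := h n.toAdd
    simp only [Finsupp.linearCombination_apply, Finsupp.sum, Finset.sum_apply,
      Pi.smul_apply] at this ⊢
    exact this
  simp [hc]

/-- In an eigenbasis, `exp (tZ)` is a sum of fixed projections with exponential coefficients.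
Exponentials are closed under products, so the algebra they generate is only their linear span. -/
theorem polyFun_exp_mem_span {p : (V →L[ℝ] V) → ℝ} (hp : p ∈ polyFun V) {Z : V →L[ℝ] V}
    (hZ : IsSymm Z) :
    (fun t : ℝ => p (NormedSpace.exp (t • Z))) ∈ Submodule.span ℝ (Set.range expFun) := by
  have hadj : (fun t : ℝ => p (NormedSpace.exp (t • Z))) ∈ Algebra.adjoin ℝ (Set.range expFun) := by
    induction hp using Algebra.adjoin_induction with
    | mem p hp =>
      obtain ⟨L, rfl⟩ := hp
      obtain ⟨b, z, hb⟩ := hZ.exists_eigenbasis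
      have he : ∀ t : ℝ, NormedSpace.exp (t • Z) =
          ∑ j, Real.exp (z j * t) • (innerSL ℝ (b j)).smulRight (b j) := by
        classical
        intro t
        refine ext_orthonormalBasis b fun i j => ?_
        rw [exp_apply_of_apply_eq_smul (eigen_smul hb t j)]
        simp [orthonormal_iff_ite.1 b.orthonormal, inner_smul_right, mul_comm]
      have : (fun t : ℝ => L (NormedSpace.exp (t • Z))) =
          ∑ j, L ((innerSL ℝ (b j)).smulRight (b j)) • expFun (Multiplicative.ofAdd (z j)) := by
        ext t
        simp [he, expFun, mul_comm]
      rw [this]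
      exact Subalgebra.sum_mem _ fun j _ =>
        Subalgebra.smul_mem _ (Algebra.subset_adjoin (Set.mem_range_self _)) _
    | algebraMap r => exact Subalgebra.algebraMap_mem _ r
    | add p q _ _ hp hq => exact Subalgebra.add_mem _ hp hq
    | mul p q _ _ hp hq => exact Subalgebra.mul_mem _ hp hq
  rw [← Subalgebra.mem_toSubmodule, Algebra.adjoin_eq_span] at hadj
  have : Submonoid.closure (Set.range expFun) = MonoidHom.mrange expFun := by
    rw [← MonoidHom.coe_mrange, Submonoid.closure_eq]
  rwa [this, MonoidHom.coe_mrange] at hadj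

theorem continuous_of_mem_polyFun {p : (V →L[ℝ] V) → ℝ} (hp : p ∈ polyFun V) : Continuous p := by
  induction hp using Algebra.adjoin_induction with
  | mem p hp =>
    obtain ⟨L, rfl⟩ := hp
    exact L.continuous_of_finiteDimensional
  | algebraMap r => exact continuous_const
  | add p q _ _ hp hq => exact hp.add hq
  | mul p q _ _ hp hq => exact hp.mul hq

theorem IsZariskiClosed.isClosed {H : Set (V →L[ℝ] V)ˣ} (hH : IsZariskiClosed H) : IsClosed H := by
  obtain ⟨I, hI, rfl⟩ := hH
  simp only [Set.ofPred_forall]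
  refine isClosed_iInter fun p => isClosed_iInter fun hp => ?_
  exact isClosed_eq ((continuous_of_mem_polyFun (hI hp)).comp Units.continuous_val)
    continuous_const

theorem expUnit_nat_smul (Z : V →L[ℝ] V) (n : ℕ) : expUnit ((n : ℝ) • Z) = expUnit Z ^ n := by
  induction n with
  | zero => apply Units.ext; simp [expUnit]
  | succ n ih =>
    rw [pow_succ, ← ih, ← expUnit_add ((Commute.refl Z).smul_left _)]
    push_cast
    rw [add_smul, one_smul]

/-- A Zariski closed subgroup that contains `exp Z`, `Z` symmetric, contains the one-parameter
group of `Z`. -/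
theorem expUnit_smul_mem {H : Subgroup (V →L[ℝ] V)ˣ}
    (hH : IsZariskiClosed (H : Set (V →L[ℝ] V)ˣ)) {Z : V →L[ℝ] V} (hZ : IsSymm Z)
    (h : expUnit Z ∈ H) (t : ℝ) : expUnit (t • Z) ∈ H := by
  obtain ⟨I, hI, hHI⟩ := hH
  have hmem : ∀ g, g ∈ H ↔ ∀ p ∈ I, p (g : V →L[ℝ] V) = 0 := fun g => by
    rw [← SetLike.mem_coe, hHI]
    rfl
  rw [hmem]
  -- Each defining polynomial vanishes at the powers of `exp Z`, that is at all natural `t`, and is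
  -- an exponential sum in `t`; so it vanishes for every real `t`.
  intro p hp
  refine congrFun (eq_zero_of_mem_span_expFun (polyFun_exp_mem_span (hI hp) hZ) fun n => ?_) t
  have := (hmem _).1 (H.pow_mem h n) p hp
  rwa [← expUnit_nat_smul] at this

theorem isOpenEmbedding_units_val :
    Topology.IsOpenEmbedding (Units.val : (V →L[ℝ] V)ˣ → (V →L[ℝ] V)) := by
  have := FiniteDimensional.complete ℝ V
  exact Units.isOpenEmbedding_val

theorem continuous_expUnit_smul (Z : V →L[ℝ] V) : Continuous fun t : ℝ => expUnit (t • Z) := by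
  have := FiniteDimensional.complete ℝ V
  let _ : NormedAlgebra ℚ (V →L[ℝ] V) := NormedAlgebra.restrictScalars ℚ ℝ _
  rw [isOpenEmbedding_units_val.isInducing.continuous_iff]
  exact NormedSpace.exp_continuous.comp (continuous_id.smul continuous_const)

end Polynomial

/-! ### Closedness of `G`, compactness of `K`, and the polar decomposition. -/

namespace SemisimpleGroup

variable {V : Type*} [NormedAddCommGroup V] [InnerProductSpace ℝ V] [FiniteDimensional ℝ V]
  (S : SemisimpleGroup V)

/-- The endomorphism underlying an element of `G`. -/
def mat : S.G →* (V →L[ℝ] V) := (Units.coeHom _).comp S.G.subtype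

theorem isInducing_mat : Topology.IsInducing S.mat :=
  isOpenEmbedding_units_val.isInducing.comp Topology.IsInducing.subtypeVal

theorem continuous_mat : Continuous S.mat := S.isInducing_mat.continuous

theorem mat_injective : Function.Injective S.mat :=
  Units.val_injective.comp Subtype.val_injective

theorem mat_mul_mat_inv (g : S.G) : S.mat g * S.mat g⁻¹ = 1 := by rw [← map_mul]; simp

theorem mat_inv_mul_mat (g : S.G) : S.mat g⁻¹ * S.mat g = 1 := by rw [← map_mul]; simp

theorem mat_inv_apply_mat (g : S.G) (v : V) : S.mat g⁻¹ (S.mat g v) = v := by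
  rw [← mul_apply_eq_comp, mat_inv_mul_mat]
  rfl

theorem mat_apply_mat_inv (g : S.G) (v : V) : S.mat g (S.mat g⁻¹ v) = v := by
  rw [← mul_apply_eq_comp, mat_mul_mat_inv]
  rfl

theorem mat_apply_ne_zero (g : S.G) {v : V} (hv : v ≠ 0) : S.mat g v ≠ 0 := by
  intro h
  apply hv
  rw [← S.mat_inv_apply_mat g v, h, map_zero]

theorem det_mat_ne_zero (g : S.G) : (S.mat g).det ≠ 0 := by
  have h : (S.mat g * S.mat g⁻¹).det = (S.mat g).det * (S.mat g⁻¹).det :=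
    LinearMap.det_comp (S.mat g : V →ₗ[ℝ] V) (S.mat g⁻¹ : V →ₗ[ℝ] V)
  rw [mat_mul_mat_inv] at h
  intro h0
  rw [h0, zero_mul] at h
  exact one_ne_zero ((LinearMap.det_id (A := ℝ) (M := V)).symm.trans h)

theorem isClosed_G : IsClosed (S.G : Set (V →L[ℝ] V)ˣ) := by
  obtain ⟨H, hH, hG⟩ := S.algebraic
  rw [hG, connectedComponentIn_eq_image H.one_mem]
  exact hH.isClosed.isClosedEmbedding_subtypeVal.isClosedMap _ isClosed_connectedComponent

/-- A limit of elements of `G` is in `G` if it is invertible. -/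
theorem exists_tendsto {u : ℕ → S.G} {T : V →L[ℝ] V}
    (h : Tendsto (fun n => S.mat (u n)) atTop (𝓝 T)) (hT : T.det ≠ 0) :
    ∃ g : S.G, S.mat g = T ∧ Tendsto u atTop (𝓝 g) := by
  have hunit : IsUnit T := by
    have h1 : IsUnit (T : V →ₗ[ℝ] V) :=
      LinearMap.isUnit_iff_isUnit_det _ |>.2 (isUnit_iff_ne_zero.2 hT)
    obtain ⟨e, he⟩ := h1
    let e' := (LinearMap.GeneralLinearGroup.generalLinearEquiv ℝ V e).toContinuousLinearEquiv
    refine ⟨⟨e', e'.symm, ?_, ?_⟩, ?_⟩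
    · ext v; exact e'.apply_symm_apply v
    · ext v; exact e'.symm_apply_apply v
    · ext v; exact LinearMap.congr_fun he v
  obtain ⟨g, rfl⟩ := hunit
  have h1 : Tendsto (fun n => (u n : (V →L[ℝ] V)ˣ)) atTop (𝓝 g) :=
    isOpenEmbedding_units_val.isInducing.tendsto_nhds_iff.2 h
  have hg : g ∈ S.G := S.isClosed_G.mem_of_tendsto h1 (Eventually.of_forall fun n => (u n).2)
  exact ⟨⟨g, hg⟩, rfl, tendsto_subtype_rng.2 h1⟩

theorem mem_K_iff {k : S.G} : k ∈ S.K ↔ ∀ v, ‖S.mat k v‖ = ‖v‖ := Iff.rfl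

theorem inner_mat_of_mem_K {k : S.G} (hk : k ∈ S.K) (v w : V) :
    inner ℝ (S.mat k v) w = inner ℝ v (S.mat k⁻¹ w) := by
  let f : V →ₗᵢ[ℝ] V := ⟨(S.mat k : V →ₗ[ℝ] V), hk⟩
  have := f.inner_map_map v (S.mat k⁻¹ w)
  rw [← this]
  change _ = inner ℝ (S.mat k v) (S.mat k (S.mat k⁻¹ w))
  rw [mat_apply_mat_inv]

theorem exists_adjoint (g : S.G) :
    ∃ g' : S.G, ∀ v w : V, inner ℝ (S.mat g v) w = inner ℝ v (S.mat g' w) := by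
  obtain ⟨g', hg', h⟩ := S.adjoint_mem g g.2
  exact ⟨⟨g', hg'⟩, h⟩

/-- Sequential compactness of `K`. -/
theorem exists_subseq_tendsto {u : ℕ → S.G} (hu : ∀ n, u n ∈ S.K) :
    ∃ k ∈ S.K, ∃ φ : ℕ → ℕ, StrictMono φ ∧ Tendsto (u ∘ φ) atTop (𝓝 k) := by
  have hb : ∀ n, S.mat (u n) ∈ Metric.closedBall (0 : V →L[ℝ] V) 1 := by
    intro n
    rw [mem_closedBall_zero_iff]
    exact ContinuousLinearMap.opNorm_le_bound _ zero_le_one fun v => by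
      rw [S.mem_K_iff.1 (hu n) v, one_mul]
  obtain ⟨T, -, φ, hφ, hT⟩ := tendsto_subseq_of_bounded Metric.isBounded_closedBall hb
  have hTn : ∀ v, ‖T v‖ = ‖v‖ := by
    intro v
    have h1 : Tendsto (fun n => ‖S.mat (u (φ n)) v‖) atTop (𝓝 ‖T v‖) :=
      (((ContinuousLinearMap.apply ℝ V v).continuous.tendsto T).comp hT).norm
    refine tendsto_nhds_unique h1 ?_
    simp [S.mem_K_iff.1 (hu _) v]
  have hdet : T.det ≠ 0 := by
    have hinj : Function.Injective (T : V →ₗ[ℝ] V) := by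
      rw [injective_iff_map_eq_zero]
      intro v hv
      have h0 : T v = 0 := hv
      rw [← norm_eq_zero, ← hTn v, h0, norm_zero]
    exact isUnit_iff_ne_zero.1 ((LinearMap.isUnit_iff_isUnit_det _).1
      ((LinearMap.isUnit_iff_ker_eq_bot _).2 (LinearMap.ker_eq_bot.2 hinj)))
  obtain ⟨k, rfl, hk⟩ := S.exists_tendsto (u := u ∘ φ) hT hdet
  exact ⟨k, hTn, φ, hφ, hk⟩

/-- `exp X` as an element of `G`. -/
def expLie {X : V →L[ℝ] V} (hX : X ∈ S.lie) : S.G :=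
  ⟨expUnit X, by simpa using (S.mem_lie X).1 hX 1⟩

theorem mat_expLie {X : V →L[ℝ] V} (hX : X ∈ S.lie) :
    S.mat (S.expLie hX) = NormedSpace.exp X := rfl

/-- A symmetric `Z` with `exp Z ∈ G` lies in the Lie algebra. -/
theorem mem_lie_of_exp_mem {Z : V →L[ℝ] V} (hZ : IsSymm Z) (h : expUnit Z ∈ S.G) : Z ∈ S.lie := by
  obtain ⟨H, hH, hG⟩ := S.algebraic
  have hGH : (S.G : Set (V →L[ℝ] V)ˣ) ⊆ H := hG ▸ connectedComponentIn_subset _ _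
  rw [S.mem_lie]
  intro t
  -- The one-parameter group lies in the ambient algebraic group; being connected and containing
  -- `1`, it stays in the identity component.
  have hpre : IsPreconnected (Set.range fun t : ℝ => expUnit (t • Z)) :=
    isPreconnected_range (continuous_expUnit_smul Z)
  have h1 : (1 : (V →L[ℝ] V)ˣ) ∈ Set.range fun t : ℝ => expUnit (t • Z) :=
    ⟨0, by apply Units.ext; simp [expUnit]⟩
  have h2 : (Set.range fun t : ℝ => expUnit (t • Z)) ⊆ (H : Set (V →L[ℝ] V)ˣ) := by
    rintro _ ⟨s, rfl⟩
    exact expUnit_smul_mem hH hZ (hGH h) s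
  have h3 := hpre.subset_connectedComponentIn h1 h2 ⟨t, rfl⟩
  rwa [← hG] at h3

/-- `g* g` is symmetric and positive, hence equal to `exp Y`, and `Z = Y / 2`. The formula for the
inner products is kept because it lets symmetries of `g` pass to `exp (2Z)`. -/
theorem exists_polar_aux (g : S.G) : ∃ (Z : V →L[ℝ] V) (hZ : Z ∈ S.lie), IsSymm Z ∧
    (∀ v w, inner ℝ (S.mat g v) (S.mat g w) = inner ℝ v (NormedSpace.exp ((2 : ℝ) • Z) w)) ∧
    g * (S.expLie hZ)⁻¹ ∈ S.K := by
  obtain ⟨g', hg'⟩ := S.exists_adjoint g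
  have hq1 : ∀ v w, inner ℝ (S.mat (g' * g) v) w = inner ℝ (S.mat g v) (S.mat g w) := by
    intro v w
    rw [real_inner_comm, map_mul, mul_apply_eq_comp, ← hg', real_inner_comm]
  have hq : IsSymm (S.mat (g' * g)) := by
    intro v w
    rw [hq1, real_inner_comm, ← hq1, real_inner_comm]
  obtain ⟨Y, hY, hYq⟩ := exists_symm_exp_eq hq (by
    intro v hv
    rw [hq1]
    exact real_inner_self_pos.2 (S.mat_apply_ne_zero g hv))
  have hYG : expUnit Y ∈ S.G := by
    have : expUnit Y = (g' * g : S.G) := Units.ext hYq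
    rw [this]
    exact (g' * g).2
  have hYl := S.mem_lie_of_exp_mem hY hYG
  have hZl : (1 / 2 : ℝ) • Y ∈ S.lie := (S.mem_lie _).2 fun t => by
    rw [smul_smul]
    exact (S.mem_lie Y).1 hYl _
  have h2 : (2 : ℝ) • ((1 / 2 : ℝ) • Y) = Y := by rw [smul_smul]; norm_num
  have hZs : IsSymm ((1 / 2 : ℝ) • Y) := hY.smul _
  refine ⟨(1 / 2 : ℝ) • Y, hZl, hZs, ?_, ?_⟩
  · intro v w
    rw [h2, hYq, ← hq1, hq]
  · set Z := (1 / 2 : ℝ) • Y with hZ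
    rw [mem_K_iff]
    intro v
    have hYZ : NormedSpace.exp Y = NormedSpace.exp Z * NormedSpace.exp Z := by
      have := congrArg Units.val (expUnit_add (Commute.refl Z))
      rw [← two_smul ℝ, h2] at this
      exact this
    have h3 : ∀ w, NormedSpace.exp Z (S.mat (S.expLie hZl)⁻¹ w) = w :=
      fun w => S.mat_apply_mat_inv (S.expLie hZl) w
    have hs := hZs.exp
    rw [← sq_eq_sq₀ (norm_nonneg _) (norm_nonneg _), ← real_inner_self_eq_norm_sq,
      ← real_inner_self_eq_norm_sq, map_mul, mul_apply_eq_comp, ← hq1, ← hYq, hYZ,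
      mul_apply_eq_comp, h3, hs, h3]

/-- The polar decomposition `G = K exp 𝔭`. -/
theorem exists_polar (g : S.G) : ∃ k ∈ S.K, ∃ (Z : V →L[ℝ] V) (hZ : Z ∈ S.lie), IsSymm Z ∧
    g = k * S.expLie hZ := by
  obtain ⟨Z, hZ, hs, -, hk⟩ := S.exists_polar_aux g
  exact ⟨_, hk, Z, hZ, hs, by group⟩

end SemisimpleGroup

attribute [local instance] LieRing.ofAssociativeRing

/-! ### The centralizer of a regular element -/

section Ad

variable {V : Type*} [NormedAddCommGroup V] [InnerProductSpace ℝ V]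

/-- `ad h` on `End V`. -/
def adEnd (h : V →L[ℝ] V) : Module.End ℝ (V →L[ℝ] V) :=
  LinearMap.mulLeft ℝ h - LinearMap.mulRight ℝ h

theorem adEnd_apply (h T : V →L[ℝ] V) : adEnd h T = h * T - T * h := rfl

theorem adEnd_commute {h h' : V →L[ℝ] V} (H : h * h' = h' * h) :
    Commute (adEnd h) (adEnd h') := by
  refine LinearMap.ext fun T => ?_
  change h * (h' * T - T * h') - (h' * T - T * h') * h =
    h' * (h * T - T * h) - (h * T - T * h) * h'
  have h1 : h * (h' * T) = h' * (h * T) := by rw [← mul_assoc, H, mul_assoc]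
  have h2 : T * h' * h = T * h * h' := by rw [mul_assoc, ← H, mul_assoc]
  simp only [mul_sub, sub_mul, h1, h2, mul_assoc]
  abel

theorem inner_adEnd {ι : Type*} [Fintype ι] {b : OrthonormalBasis ι ℝ V} {l : ι → ℝ}
    {h : V →L[ℝ] V} (hb : ∀ i, h (b i) = l i • b i) (T : V →L[ℝ] V) (i j : ι) :
    inner ℝ (b i) (adEnd h T (b j)) = (l i - l j) * inner ℝ (b i) (T (b j)) := by
  have hs : IsSymm h := isSymm_of_eigenbasis hb
  rw [adEnd_apply, sub_apply, mul_apply_eq_comp, mul_apply_eq_comp, inner_sub_right,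
    hs.inner_apply_eigen hb, hb, map_smul, real_inner_smul_right]
  ring

theorem blockDiag_commute {ι : Type*} [Fintype ι] {b : OrthonormalBasis ι ℝ V} {l : ι → ℝ}
    {X : V →L[ℝ] V} (hb : ∀ i, X (b i) = l i • b i) (T : V →L[ℝ] V) :
    blockDiag b l T * X = X * blockDiag b l T := by
  refine ext_orthonormalBasis b fun i j => ?_
  have hs : IsSymm X := isSymm_of_eigenbasis hb
  rw [mul_apply_eq_comp, mul_apply_eq_comp, hs.inner_apply_eigen hb, hb, map_smul,
    real_inner_smul_right, blockDiag, inner_ofEntries]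
  split_ifs with h
  · rw [h]
  · simp

variable [FiniteDimensional ℝ V]

/-- Since `h` is diagonalizable, `ad h - μ` multiplies each matrix entry by a scalar, and a scalar
with a vanishing power is zero: generalized eigenvectors are eigenvectors. -/
theorem mem_maxGenEigenspace_adEnd {h : V →L[ℝ] V} (hs : IsSymm h) {μ : ℝ} {T : V →L[ℝ] V} :
    T ∈ (adEnd h).maxGenEigenspace μ ↔ adEnd h T = μ • T := by
  obtain ⟨b, l, hb⟩ := hs.exists_eigenbasis
  constructor
  · intro hT
    obtain ⟨k, hk⟩ := (Module.End.mem_maxGenEigenspace _ _ _).1 hT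
    have key : ∀ k : ℕ, ∀ i j, inner ℝ (b i)
        ((((adEnd h - μ • (1 : Module.End ℝ (V →L[ℝ] V))) ^ k) T) (b j)) =
        (l i - l j - μ) ^ k * inner ℝ (b i) (T (b j)) := by
      intro k
      induction k with
      | zero => simp
      | succ k ih =>
        intro i j
        rw [pow_succ', Module.End.mul_apply, LinearMap.sub_apply, sub_apply, inner_sub_right,
          inner_adEnd hb, LinearMap.smul_apply, Module.End.one_apply, smul_apply,
          real_inner_smul_right, ih]
        ring
    refine ext_orthonormalBasis b fun i j => ?_
    have h1 := key k i j
    rw [hk] at h1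
    rw [inner_adEnd hb, smul_apply, real_inner_smul_right]
    rcases mul_eq_zero.1 (h1.symm.trans (by simp)) with h2 | h2
    · have h3 : l i - l j - μ = 0 := by
        by_contra h
        exact pow_ne_zero k h h2
      rw [sub_eq_zero.1 h3]
    · simp [h2]
  · intro hT
    refine (Module.End.mem_maxGenEigenspace _ _ _).2 ⟨1, ?_⟩
    simp [hT]

/-- The elementary matrices of an eigenbasis of `h` are eigenvectors of `ad h`, with eigenvalues `l
i - l j`. -/
theorem iSup_maxGenEigenspace_adEnd {h : V →L[ℝ] V} (hs : IsSymm h) :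
    ⨆ μ, (adEnd h).maxGenEigenspace μ = ⊤ := by
  classical
  obtain ⟨b, l, hb⟩ := hs.exists_eigenbasis
  rw [eq_top_iff]
  rintro T -
  have hT : T = ofEntries b fun i j => inner ℝ (b i) (T (b j)) :=
    ext_orthonormalBasis b fun i j => by rw [inner_ofEntries]
  rw [hT, ofEntries]
  refine Submodule.sum_mem _ fun i _ => Submodule.sum_mem _ fun j _ => Submodule.smul_mem _ _ ?_
  refine Submodule.mem_iSup_of_mem (l i - l j) ((mem_maxGenEigenspace_adEnd hs).2 ?_)
  refine ext_orthonormalBasis b fun i' j' => ?_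
  rw [inner_adEnd hb, smul_apply, real_inner_smul_right]
  by_cases h1 : i' = i <;> by_cases h2 : j = j' <;>
    simp [h1, h2, orthonormal_iff_ite.1 b.orthonormal]

end Ad

/-! ### Simultaneous diagonalization of `ad 𝔞`. -/

namespace SemisimpleGroup

variable {V : Type*} [NormedAddCommGroup V] [InnerProductSpace ℝ V] [FiniteDimensional ℝ V]
  (S : SemisimpleGroup V)

/-- The centralizer of the regular element `chamber` in the Lie algebra commutes with `𝔞`. -/
theorem commute_of_commute_chamber {Z : V →L[ℝ] V} (hZ : Z ∈ S.lie)
    (hc : (S.chamber : V →L[ℝ] V) * Z = Z * S.chamber) {Y : V →L[ℝ] V} (hY : Y ∈ S.𝔞) :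
    Z * Y = Y * Z := by
  let W : Submodule ℝ (V →L[ℝ] V) := S.lie.toSubmodule ⊓ LinearMap.ker (adEnd S.chamber)
  have hW : ∀ h : S.𝔞, ∀ T ∈ W, adEnd (h : V →L[ℝ] V) T ∈ W := by
    rintro h T ⟨hT, hT'⟩
    refine ⟨S.lie.lie_mem (S.𝔞_lie _ h.2) hT, ?_⟩
    change adEnd (S.chamber : V →L[ℝ] V) T = 0 at hT'
    change adEnd (S.chamber : V →L[ℝ] V) (adEnd (h : V →L[ℝ] V) T) = 0
    rw [← Module.End.mul_apply, (adEnd_commute (S.𝔞_comm _ S.chamber.2 _ h.2)).eq,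
      Module.End.mul_apply, hT', map_zero]
  let F : S.𝔞 → Module.End ℝ W := fun h => (adEnd (h : V →L[ℝ] V)).restrict (hW h)
  have hF : ∀ (h : S.𝔞) (μ : ℝ) (x : W), x ∈ (F h).maxGenEigenspace μ →
      adEnd (h : V →L[ℝ] V) x = μ • (x : V →L[ℝ] V) := by
    intro h μ x hx
    rw [← mem_maxGenEigenspace_adEnd (S.𝔞_symm _ h.2)]
    have : (x : V →L[ℝ] V) ∈ ((F h).maxGenEigenspace μ).map W.subtype := ⟨x, hx, rfl⟩
    rw [Module.End.maxGenEigenspace, ← Submodule.inf_genEigenspace _ _ (hW h)] at this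
    exact this.2
  -- The operators `ad h`, `h ∈ 𝔞`, commute and are diagonalizable on the centralizer `W` of
  -- `chamber`, so their joint eigenspaces span `W`.
  have htop : ⨆ χ : S.𝔞 → ℝ, ⨅ h, (F h).maxGenEigenspace (χ h) = ⊤ := by
    refine Module.End.iSup_iInf_maxGenEigenspace_eq_top_of_iSup_maxGenEigenspace_eq_top_of_commute
      F (fun h h' _ => ?_) fun h =>
        Module.End.genEigenspace_restrict_eq_top _ (iSup_maxGenEigenspace_adEnd (S.𝔞_symm _ h.2))
    ext1 x
    apply Subtype.ext
    exact LinearMap.congr_fun (adEnd_commute (S.𝔞_comm _ h.2 _ h'.2)).eq (x : V →L[ℝ] V)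
  let U : Submodule ℝ W := ⨅ h, LinearMap.ker (F h)
  have hle : ⨆ χ : S.𝔞 → ℝ, ⨅ h, (F h).maxGenEigenspace (χ h) ≤ U := by
    refine iSup_le fun χ x hx => ?_
    rw [Submodule.mem_iInf] at hx
    have hx' := fun h => hF h _ x (hx h)
    by_cases hx0 : x = 0
    · rw [hx0]; exact U.zero_mem
    have hx1 : (x : V →L[ℝ] V) ≠ 0 := fun h => hx0 (Subtype.ext h)
    have hinj := smul_left_injective ℝ hx1
    let α : Module.Dual ℝ S.𝔞 :=
      { toFun := χ
        map_add' := fun h h' => hinj (by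
          change χ (h + h') • (x : V →L[ℝ] V) = (χ h + χ h') • (x : V →L[ℝ] V)
          rw [add_smul, ← hx', ← hx', ← hx']
          simp only [adEnd_apply, Submodule.coe_add, add_mul, mul_add]
          abel)
        map_smul' := fun c h => hinj (by
          change χ (c • h) • (x : V →L[ℝ] V) = (c * χ h) • (x : V →L[ℝ] V)
          rw [mul_smul, ← hx', ← hx']
          simp only [adEnd_apply, Submodule.coe_smul, smul_mul_assoc, mul_smul_comm, smul_sub]) }
    -- A nonzero joint eigenvalue on `W` would be a restricted root that vanishes at `chamber`,
    -- against regularity.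
    have hα : α = 0 := by
      by_contra hne
      refine S.regular α hne ⟨x, x.2.1, hx1, hx'⟩ ?_
      have h1 : adEnd (S.chamber : V →L[ℝ] V) x = 0 := x.2.2
      rw [hx'] at h1
      exact (smul_eq_zero.1 h1).resolve_right hx1
    rw [Submodule.mem_iInf]
    intro h
    apply Subtype.ext
    change adEnd (h : V →L[ℝ] V) x = 0
    rw [hx', show χ h = α h from rfl, hα]
    simp
  rw [htop] at hle
  have hZW : Z ∈ W := ⟨hZ, by
    change adEnd (S.chamber : V →L[ℝ] V) Z = 0
    rw [adEnd_apply, hc, sub_self]⟩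
  have h1 := (Submodule.mem_iInf _).1 (hle (Submodule.mem_top (x := (⟨Z, hZW⟩ : W)))) ⟨Y, hY⟩
  have h2 : adEnd Y Z = 0 := congrArg Subtype.val h1
  rw [adEnd_apply, sub_eq_zero] at h2
  exact h2.symm

theorem mem_𝔞_of_commute_chamber {Z : V →L[ℝ] V} (hZ : Z ∈ S.lie) (hs : IsSymm Z)
    (hc : (S.chamber : V →L[ℝ] V) * Z = Z * S.chamber) : Z ∈ S.𝔞 :=
  S.𝔞_max Z hZ hs fun _ hY => S.commute_of_commute_chamber hZ hc hY

/-- There are finitely many restricted roots. -/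
theorem finite_isRoot : {α | S.IsRoot α}.Finite := by
  -- Root spaces are independent nonzero subspaces of the finite-dimensional `End V`.
  have hind : iSupIndep fun χ : S.𝔞 → ℝ =>
      ⨅ h : S.𝔞, (adEnd (h : V →L[ℝ] V)).maxGenEigenspace (χ h) :=
    Module.End.independent_iInf_maxGenEigenspace_of_forall_mapsTo _ fun h h' μ =>
      Module.End.mapsTo_maxGenEigenspace_of_comm (adEnd_commute (S.𝔞_comm _ h'.2 _ h.2)) μ
  refine Set.Finite.of_finite_image (f := fun α : Module.Dual ℝ S.𝔞 => (α : S.𝔞 → ℝ))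
    (Set.Finite.subset (WellFoundedGT.finite_ne_bot_of_iSupIndep hind) ?_)
    DFunLike.coe_injective.injOn
  rintro _ ⟨α, ⟨-, X, -, hX0, hX⟩, rfl⟩
  rw [Set.mem_ofPred_eq, Submodule.ne_bot_iff]
  refine ⟨X, ?_, hX0⟩
  rw [Submodule.mem_iInf]
  exact fun h => (mem_maxGenEigenspace_adEnd (S.𝔞_symm _ h.2)).2 (hX h)

/-! ### The Iwasawa decomposition -/

/-- The element `exp chamber` of the interior of `A⁺`. -/
def regElt : S.G := S.exp𝔞 (Multiplicative.ofAdd S.chamber)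

theorem chamber_symm : IsSymm (S.chamber : V →L[ℝ] V) := S.𝔞_symm _ S.chamber.2

theorem regElt_pow (n : ℕ) :
    S.mat (S.regElt ^ n) = NormedSpace.exp ((n : ℝ) • (S.chamber : V →L[ℝ] V)) := by
  have := congrArg Units.val (expUnit_nat_smul (S.chamber : V →L[ℝ] V) n)
  rw [expUnit_val] at this
  rw [this]
  rfl

theorem regElt_pow_inv (n : ℕ) :
    S.mat (S.regElt ^ n)⁻¹ = NormedSpace.exp (-((n : ℝ) • (S.chamber : V →L[ℝ] V))) := by
  have h1 : (expUnit ((n : ℝ) • (S.chamber : V →L[ℝ] V))) = (S.regElt ^ n : S.G) :=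
    Units.ext (S.regElt_pow n).symm
  change (((((S.regElt ^ n : S.G) : (V →L[ℝ] V)ˣ))⁻¹ : (V →L[ℝ] V)ˣ) : V →L[ℝ] V) = _
  rw [← h1, expUnit_inv, expUnit_val]

theorem mat_conj (n : ℕ) (g : S.G) : S.mat ((S.regElt ^ n)⁻¹ * g * S.regElt ^ n) =
    conjExp S.chamber n (S.mat g) := by
  rw [map_mul, map_mul, regElt_pow_inv, regElt_pow]
  rfl

theorem tendsto_conj_iff {g d : S.G} :
    Tendsto (fun n : ℕ => (S.regElt ^ n)⁻¹ * g * S.regElt ^ n) atTop (𝓝 d) ↔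
      Tendsto (fun n : ℕ => conjExp S.chamber n (S.mat g)) atTop (𝓝 (S.mat d)) := by
  rw [S.isInducing_mat.tendsto_nhds_iff]
  simp only [Function.comp_def, mat_conj]

theorem mem_N_iff {g : S.G} : g ∈ S.N ↔
    Tendsto (fun n : ℕ => (S.regElt ^ n)⁻¹ * g * S.regElt ^ n) atTop (𝓝 1) := Iff.rfl

/-- Conjugation by `aᵐ` fixes `d`, so it acts only on `n`. This reads off the `MA`-part of an
element as the limit of its conjugates. -/
theorem mem_N_iff_of_commute {d n : S.G} (hd : Commute d S.regElt) : n ∈ S.N ↔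
    Tendsto (fun m : ℕ => (S.regElt ^ m)⁻¹ * (d * n) * S.regElt ^ m) atTop (𝓝 d) := by
  have h : ∀ m : ℕ, (S.regElt ^ m)⁻¹ * (d * n) * S.regElt ^ m =
      d * ((S.regElt ^ m)⁻¹ * n * S.regElt ^ m) := by
    intro m
    rw [← mul_assoc, ← ((hd.pow_right m).inv_right).eq]
    simp only [mul_assoc]
  rw [mem_N_iff]
  constructor
  · intro h1
    simpa [h] using h1.const_mul d
  · intro h1
    simpa [h] using h1.const_mul d⁻¹

theorem conj_mem_N {c n : S.G} (hc : Commute c S.regElt) (hn : n ∈ S.N) : c⁻¹ * n * c ∈ S.N := by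
  have h : ∀ m : ℕ, (S.regElt ^ m)⁻¹ * (c⁻¹ * n * c) * S.regElt ^ m =
      c⁻¹ * ((S.regElt ^ m)⁻¹ * n * S.regElt ^ m) * c := by
    intro m
    have h1 := (hc.pow_right m).eq
    have h2 := ((hc.pow_right m).inv_right).inv_left.eq
    calc _ = ((S.regElt ^ m)⁻¹ * c⁻¹) * n * (c * S.regElt ^ m) := by simp only [mul_assoc]
      _ = _ := by rw [h1, ← h2]; simp only [mul_assoc]
  rw [mem_N_iff] at hn ⊢
  simpa [h] using (hn.const_mul c⁻¹).mul_const c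

theorem e_add (h h' : S.𝔞) : S.frame.e (h + h') = S.frame.e h * S.frame.e h' :=
  map_mul S.exp𝔞 _ _

theorem e_neg (h : S.𝔞) : S.frame.e (-h) = (S.frame.e h)⁻¹ := map_inv S.exp𝔞 _

theorem e_zero : S.frame.e 0 = 1 := map_one S.exp𝔞

theorem mat_e (h : S.𝔞) : S.mat (S.frame.e h) = NormedSpace.exp (h : V →L[ℝ] V) := rfl

theorem commute_e (h h' : S.𝔞) : Commute (S.frame.e h) (S.frame.e h') := by
  rw [commute_iff_eq, ← e_add, ← e_add, add_comm]

theorem commute_e_regElt (h : S.𝔞) : Commute (S.frame.e h) S.regElt := S.commute_e h S.chamber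

theorem commute_regElt_of_commute {d : S.G} (hd : S.mat d * S.chamber = S.chamber * S.mat d) :
    Commute d S.regElt := by
  apply S.mat_injective
  rw [map_mul, map_mul]
  have h : Commute (S.mat d) (S.chamber : V →L[ℝ] V) := hd
  exact h.exp_right

/-- Elements of `G` that commute with `chamber` lie in `K A`. -/
theorem exists_mem_K_mul_e {d : S.G} (hd : S.mat d * S.chamber = S.chamber * S.mat d) :
    ∃ k ∈ S.K, ∃ h : S.𝔞, d = k * S.frame.e h := by
  obtain ⟨Z, hZ, hs, hin, hk⟩ := S.exists_polar_aux d
  -- `exp (2Z)` is `d* d`, and `chamber` is symmetric and commutes with `d`.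
  have hcomm : (S.chamber : V →L[ℝ] V) * NormedSpace.exp ((2 : ℝ) • Z) =
      NormedSpace.exp ((2 : ℝ) • Z) * S.chamber := by
    ext w
    refine ext_inner_left ℝ fun v => ?_
    have hd' : ∀ v, S.mat d ((S.chamber : V →L[ℝ] V) v) = (S.chamber : V →L[ℝ] V) (S.mat d v) :=
      fun v => DFunLike.congr_fun hd v
    rw [mul_apply_eq_comp, mul_apply_eq_comp, ← S.chamber_symm, ← hin, ← hin, hd', hd',
      S.chamber_symm]
  have h2 := (hs.smul 2).commute_of_commute_exp hcomm
  rw [mul_smul_comm, smul_mul_assoc] at h2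
  have hZa : Z ∈ S.𝔞 := S.mem_𝔞_of_commute_chamber hZ hs
    (smul_right_injective _ (two_ne_zero (α := ℝ)) h2)
  refine ⟨_, hk, ⟨Z, hZa⟩, ?_⟩
  have : S.frame.e ⟨Z, hZa⟩ = S.expLie hZ := rfl
  rw [this]
  group

/-- The Iwasawa decomposition `G = KAN`. -/
theorem exists_iwasawa (g : S.G) :
    ∃ k ∈ S.K, ∃ h : S.𝔞, ∃ n ∈ S.N, g = k * S.frame.e h * n := by
  -- The `K`-part of `g` is sought among the limits of the polar `K`-parts `k n` of `g aⁿ`.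
  choose k hk Z hZ hs hkZ using fun n : ℕ => S.exists_polar (g * S.regElt ^ n)
  obtain ⟨k', hk', φ, hφ, hlim⟩ := S.exists_subseq_tendsto hk
  obtain ⟨b, l, hb⟩ := S.chamber_symm.exists_eigenbasis
  set r := k'⁻¹ * g with hr
  have hrlim : Tendsto (fun n => S.mat ((k (φ n))⁻¹ * g)) atTop (𝓝 (S.mat r)) :=
    (S.continuous_mat.tendsto _).comp (hlim.inv.mul_const g)
  have hrn : ∀ n, S.regElt ^ n = ((k n)⁻¹ * g)⁻¹ * S.expLie (hZ n) := by
    intro n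
    rw [mul_inv_rev, inv_inv, mul_assoc, ← hkZ]
    group
  -- Since `(k n)⁻¹ g = exp (Z n) a⁻ⁿ`, its conjugate by `aⁿ` is `a⁻ⁿ exp (Z n)`, which is its
  -- transpose. Thus the conjugates converge along with the elements, and the limit `r` has to be
  -- block upper triangular.
  have hconj : ∀ (n : ℕ) i j, inner ℝ (b i) (conjExp S.chamber n (S.mat ((k n)⁻¹ * g)) (b j)) =
      inner ℝ (b j) (S.mat ((k n)⁻¹ * g) (b i)) := by
    intro n i j
    have hsymm : IsSymm (S.mat (S.regElt ^ n)⁻¹) := by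
      rw [regElt_pow_inv, ← neg_smul]
      exact (S.chamber_symm.smul _).exp
    rw [← mat_conj]
    have h1 : (S.regElt ^ n)⁻¹ * ((k n)⁻¹ * g) * S.regElt ^ n =
        (S.regElt ^ n)⁻¹ * S.expLie (hZ n) := by
      conv_lhs => rw [mul_assoc]; arg 2; rw [hrn n]
      group
    have h2 : (k n)⁻¹ * g = S.expLie (hZ n) * (S.regElt ^ n)⁻¹ := by
      rw [hrn n]
      group
    rw [h1, h2, map_mul, map_mul, mul_apply_eq_comp, mul_apply_eq_comp, ← hsymm,
      mat_expLie, ← (hs n).exp, real_inner_comm]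
  have hup : IsUpper b l (S.mat r) := by
    refine isUpper_of_tendsto (L := ofEntries b fun i j => inner ℝ (b j) (S.mat r (b i))) hb
      hφ.tendsto_atTop hrlim ?_
    rw [tendsto_iff_inner_orthonormalBasis b] at hrlim ⊢
    intro i j
    simp only [hconj, inner_ofEntries]
    exact hrlim j i
  have hD := conjExp_tendsto hb hup
  have hdet : (blockDiag b l (S.mat r)).det ≠ 0 := by
    rw [det_blockDiag hb hup]
    exact S.det_mat_ne_zero r
  have hD' : Tendsto (fun n : ℕ => S.mat ((S.regElt ^ n)⁻¹ * r * S.regElt ^ n)) atTop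
      (𝓝 (blockDiag b l (S.mat r))) := by simpa only [mat_conj] using hD
  -- The block diagonal part `d` of `r` belongs to `G`; it contributes to `K A`, and `d⁻¹ r` is the
  -- `N`-part.
  obtain ⟨d, hd, hdlim⟩ := S.exists_tendsto hD' hdet
  have hdc : S.mat d * S.chamber = S.chamber * S.mat d := hd ▸ blockDiag_commute hb _
  have hn : d⁻¹ * r ∈ S.N := by
    rw [S.mem_N_iff_of_commute (S.commute_regElt_of_commute hdc), mul_inv_cancel_left]
    exact hdlim
  obtain ⟨k₁, hk₁, h, hh⟩ := S.exists_mem_K_mul_e hdc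
  refine ⟨k' * k₁, S.K.mul_mem hk' hk₁, h, _, hn, ?_⟩
  rw [mul_assoc k', ← hh, hr]
  group

end SemisimpleGroup

namespace SemisimpleGroup

variable {V : Type*} [NormedAddCommGroup V] [InnerProductSpace ℝ V] [FiniteDimensional ℝ V]
  (S : SemisimpleGroup V)

/-! ### Uniqueness in the Iwasawa decomposition -/

/-- On `K` inversion is transposition, which swaps conjugation by `aᵐ` and by `a⁻ᵐ`. Hence the
conjugates of `k⁻¹` converge in both directions, to `exp (-h)` and to `exp h`; then they are
constant, so `exp (2h) = 1`. -/
theorem eq_zero_of_e_mul_mem_K {h : S.𝔞} {n : S.G} (hn : n ∈ S.N)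
    (hk : S.frame.e h * n ∈ S.K) : h = 0 ∧ n = 1 := by
  obtain ⟨b, l, hb⟩ := S.chamber_symm.exists_eigenbasis
  set k := S.frame.e h * n with hkdef
  have h1 := (S.mem_N_iff_of_commute (S.commute_e_regElt h)).1 hn
  rw [← hkdef] at h1
  have h2 := h1.inv
  simp only [mul_inv_rev, inv_inv, ← mul_assoc] at h2
  rw [tendsto_conj_iff] at h1
  rw [tendsto_conj_iff] at h2
  have h3 : Tendsto (fun n : ℕ => conjExp S.chamber (-n) (S.mat k⁻¹)) atTop
      (𝓝 (S.mat (S.frame.e h))) := by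
    rw [tendsto_iff_inner_orthonormalBasis b] at h1 ⊢
    intro i j
    have h4 : ∀ n : ℕ, inner ℝ (b i) (conjExp S.chamber (-n) (S.mat k⁻¹) (b j)) =
        inner ℝ (b j) (conjExp S.chamber n (S.mat k) (b i)) := by
      intro n
      rw [inner_conjExp hb, inner_conjExp hb, ← S.inner_mat_of_mem_K hk, real_inner_comm]
      congr 2
      ring
    simp only [h4]
    rw [mat_e, ← (S.𝔞_symm _ h.2).exp, real_inner_comm, ← mat_e]
    exact h1 j i
  have hc := conjExp_eq_self S.chamber_symm h2 h3
  simp only [hc] at h2 h3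
  have e1 := tendsto_nhds_unique h2 tendsto_const_nhds
  have e2 := tendsto_nhds_unique h3 tendsto_const_nhds
  have e3 : (S.frame.e h)⁻¹ = k⁻¹ := S.mat_injective e1
  have e4 : S.frame.e h = k⁻¹ := S.mat_injective e2
  have e5 : S.frame.e (h + h) = 1 := by
    rw [e_add]
    nth_rewrite 2 [e4]
    rw [← e3, mul_inv_cancel]
  have hh : h = 0 := by
    have h6 : NormedSpace.exp ((h + h : S.𝔞) : V →L[ℝ] V) = 1 := by
      rw [← mat_e, e5, map_one]
    have h7 : h + h = 0 :=
      Subtype.ext ((S.𝔞_symm _ (h + h).2).eq_zero_of_exp_eq_one h6)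
    rw [← two_smul ℝ] at h7
    exact (smul_eq_zero.1 h7).resolve_left two_ne_zero
  refine ⟨hh, ?_⟩
  rw [hh, e_zero, inv_one, eq_comm, inv_eq_one] at e3
  rw [hkdef, hh, e_zero, one_mul] at e3
  exact e3

theorem eq_of_e_mul_eq {k k' : S.G} (hk : k ∈ S.K) (hk' : k' ∈ S.K) {h h' : S.𝔞} {n n' : S.G}
    (hn : n ∈ S.N) (hn' : n' ∈ S.N)
    (H : k * S.frame.e h * n = k' * S.frame.e h' * n') : h = h' := by
  have h1 : S.frame.e (h' - h) * (S.frame.e h * (n' * n⁻¹) * (S.frame.e h)⁻¹) = k'⁻¹ * k := by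
    rw [sub_eq_add_neg, e_add, e_neg]
    have h2 : k = k' * S.frame.e h' * n' * n⁻¹ * (S.frame.e h)⁻¹ := by rw [← H]; group
    conv_rhs => rw [h2]
    group
  have h3 : S.frame.e h * (n' * n⁻¹) * (S.frame.e h)⁻¹ ∈ S.N := by
    have := S.conj_mem_N (c := (S.frame.e h)⁻¹) (S.commute_e_regElt h).inv_left
      (S.N.mul_mem hn' (S.N.inv_mem hn))
    rwa [inv_inv] at this
  have h4 := (S.eq_zero_of_e_mul_mem_K h3 (h1 ▸ S.K.mul_mem (S.K.inv_mem hk') hk)).1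
  exact (sub_eq_zero.1 h4).symm

/-! ### The minimal parabolic subgroup -/

theorem commute_of_mem_M {m : S.G} (hm : m ∈ S.frame.M) (h : S.𝔞) : Commute m (S.frame.e h) :=
  (hm.2 (S.frame.e h) ⟨Multiplicative.ofAdd h, rfl⟩).symm

theorem commute_regElt_of_mem_M {m : S.G} (hm : m ∈ S.frame.M) : Commute m S.regElt :=
  S.commute_of_mem_M hm S.chamber

/-- `M` commutes with `A`, and both commute with `a`, so they normalize `N`; the set of products
`MAN` is already a subgroup. -/
theorem mem_P_iff {p : S.G} :
    p ∈ S.frame.P ↔ ∃ m ∈ S.frame.M, ∃ h, ∃ n ∈ S.N, p = m * S.frame.e h * n := by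
  constructor
  · let Q : Subgroup S.G :=
      { carrier := {p | ∃ m ∈ S.frame.M, ∃ h, ∃ n ∈ S.N, p = m * S.frame.e h * n}
        one_mem' := ⟨1, S.frame.M.one_mem, 0, 1, S.N.one_mem, by simp [e_zero]⟩
        mul_mem' := by
          rintro _ _ ⟨m, hm, h, n, hn, rfl⟩ ⟨m', hm', h', n', hn', rfl⟩
          have hc := (S.commute_regElt_of_mem_M hm').mul_left (S.commute_e_regElt h')
          refine ⟨m * m', S.frame.M.mul_mem hm hm', h + h', _,
            S.N.mul_mem (S.conj_mem_N hc hn) hn', ?_⟩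
          have h1 := (S.commute_of_mem_M hm' h).eq
          calc _ = m * (S.frame.e h * m') * S.frame.e h' *
                ((m' * S.frame.e h')⁻¹ * n * (m' * S.frame.e h')) * n' := by group
            _ = _ := by rw [← h1, e_add]; simp only [mul_assoc]
        inv_mem' := by
          rintro _ ⟨m, hm, h, n, hn, rfl⟩
          have hc := ((S.commute_regElt_of_mem_M hm).mul_left (S.commute_e_regElt h)).inv_left
          refine ⟨m⁻¹, S.frame.M.inv_mem hm, -h, _, S.conj_mem_N hc (S.N.inv_mem hn), ?_⟩
          have h1 := (S.commute_of_mem_M hm h).inv_inv.eq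
          rw [e_neg, h1]
          group }
    have hle : S.frame.P ≤ Q := by
      refine sup_le (sup_le ?_ ?_) ?_
      · intro m hm
        exact ⟨m, hm, 0, 1, S.N.one_mem, by simp [e_zero]⟩
      · rintro _ ⟨h, rfl⟩
        exact ⟨1, S.frame.M.one_mem, h.toAdd, 1, S.N.one_mem, by simp; rfl⟩
      · intro n hn
        exact ⟨1, S.frame.M.one_mem, 0, n, hn, by simp [e_zero]⟩
    exact fun hp => hle hp
  · rintro ⟨m, hm, h, n, hn, rfl⟩
    refine S.frame.P.mul_mem (S.frame.P.mul_mem ?_ ?_) ?_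
    · exact (le_sup_left.trans le_sup_left : S.frame.M ≤ S.frame.P) hm
    · exact (le_sup_right.trans le_sup_left : S.frame.A ≤ S.frame.P) ⟨_, rfl⟩
    · exact (le_sup_right : S.frame.N ≤ S.frame.P) hn

theorem mem_M_of_mem_K_of_mem_P {k : S.G} (hk : k ∈ S.K) (hp : k ∈ S.frame.P) :
    k ∈ S.frame.M := by
  obtain ⟨m, hm, h, n, hn, rfl⟩ := S.mem_P_iff.1 hp
  have h1 : S.frame.e h * n ∈ S.K := by
    have := S.K.mul_mem (S.K.inv_mem hm.1) hk
    rwa [mul_assoc, inv_mul_cancel_left] at this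
  obtain ⟨rfl, rfl⟩ := S.eq_zero_of_e_mul_mem_K hn h1
  simpa [e_zero] using hm

/-- For `m exp(h) n` convergent, the `M`-parts subconverge by compactness of `K`. The factor `exp h`
is the block diagonal part of `exp(h) n`, a continuous function, so it converges too, with
invertible limit. Bounds on `exp (± h)` then bound `h`, and what remains lies in `N`. -/
theorem isClosed_P : IsClosed (S.frame.P : Set S.G) := by
  have : FirstCountableTopology S.G := S.isInducing_mat.firstCountableTopology
  refine IsSeqClosed.isClosed ?_
  intro p g hp hg
  choose m hm h n hn hpn using fun i => S.mem_P_iff.1 (hp i)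
  obtain ⟨k, hk, φ, hφ, hlim⟩ := S.exists_subseq_tendsto fun i => (hm i).1
  have hkM : k ∈ S.frame.M := by
    refine ⟨hk, fun a ha => ?_⟩
    have h1 : Tendsto (fun i => a * m (φ i)) atTop (𝓝 (a * k)) := hlim.const_mul a
    have h2 : Tendsto (fun i => m (φ i) * a) atTop (𝓝 (k * a)) := hlim.mul_const a
    refine tendsto_nhds_unique h1 (h2.congr fun i => ?_)
    exact ((hm (φ i)).2 a ha).symm
  set s := k⁻¹ * g with hs
  have hslim : Tendsto (fun i => S.frame.e (h (φ i)) * n (φ i)) atTop (𝓝 s) := by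
    refine (hlim.inv.mul (hg.comp hφ.tendsto_atTop)).congr fun i => ?_
    simp only [Function.comp_apply, hpn]
    group
  obtain ⟨b, l, hb⟩ := S.chamber_symm.exists_eigenbasis
  have hup := fun i => isUpper_of_conjExp_tendsto hb (S.tendsto_conj_iff.1
    ((S.mem_N_iff_of_commute (S.commute_e_regElt (h (φ i)))).1 (hn (φ i))))
  have hsmat := (S.continuous_mat.tendsto _).comp hslim
  have hsup : IsUpper b l (S.mat s) := IsUpper.of_tendsto hsmat fun i => (hup i).1
  have hdet : (blockDiag b l (S.mat s)).det ≠ 0 := by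
    rw [det_blockDiag hb hsup]
    exact S.det_mat_ne_zero s
  have hblock : Tendsto (fun i => S.mat (S.frame.e (h (φ i)))) atTop
      (𝓝 (blockDiag b l (S.mat s))) := by
    simp only [(hup _).2]
    exact blockDiag_tendsto hsmat
  obtain ⟨d, hd, hdlim⟩ := S.exists_tendsto hblock hdet
  obtain ⟨C₁, hC₁⟩ := hblock.norm.bddAbove_range
  obtain ⟨C₂, hC₂⟩ := ((S.continuous_mat.tendsto _).comp hdlim.inv).norm.bddAbove_range
  have hbound : ∀ i, h (φ i) ∈ Metric.closedBall (0 : S.𝔞) (Real.log (max 1 (max C₁ C₂))) := by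
    intro i
    rw [mem_closedBall_zero_iff]
    refine (S.𝔞_symm _ (h (φ i)).2).norm_le_log (le_max_left _ _) ?_ ?_
    · exact (hC₁ ⟨i, rfl⟩).trans ((le_max_left _ _).trans (le_max_right _ _))
    · exact (hC₂ ⟨i, rfl⟩).trans ((le_max_right _ _).trans (le_max_right _ _))
  obtain ⟨h', -, χ, hχ, hh'⟩ := tendsto_subseq_of_bounded Metric.isBounded_closedBall hbound
  have hde : d = S.frame.e h' := by
    apply S.mat_injective
    have := FiniteDimensional.complete ℝ V
    let _ : NormedAlgebra ℚ (V →L[ℝ] V) := NormedAlgebra.restrictScalars ℚ ℝ _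
    have hcont : Continuous fun h : S.𝔞 => S.mat (S.frame.e h) :=
      NormedSpace.exp_continuous.comp continuous_subtype_val
    rw [hd]
    exact tendsto_nhds_unique (hblock.comp hχ.tendsto_atTop) ((hcont.tendsto h').comp hh')
  have hn' : (S.frame.e h')⁻¹ * s ∈ S.N := by
    rw [S.mem_N_iff_of_commute (S.commute_e_regElt h'), mul_inv_cancel_left, tendsto_conj_iff,
      ← hde, hd]
    exact conjExp_tendsto hb hsup
  refine S.mem_P_iff.2 ⟨k, hkM, h', _, hn', ?_⟩
  rw [hs]
  group

theorem exists_isIwasawa (g : S.G) (ξ : S.frame.Flag) : ∃ h, S.frame.IsIwasawa g ξ h := by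
  obtain ⟨x, rfl⟩ := QuotientGroup.mk_surjective ξ
  obtain ⟨k, hk, h, n, hn, rfl⟩ := S.exists_iwasawa x
  obtain ⟨k', hk', h', n', hn', H⟩ := S.exists_iwasawa (g * k)
  refine ⟨h', k, hk, ?_, k', hk', n', hn', H⟩
  -- For `x = k exp(h) n`, the element `x⁻¹ k = n⁻¹ exp(-h)` is rewritten with `exp(-h)` on the
  -- left.
  refine (QuotientGroup.eq (s := S.frame.P)).2 (S.mem_P_iff.2
    ⟨1, S.frame.M.one_mem, -h, S.frame.e h * n⁻¹ * (S.frame.e h)⁻¹, ?_, ?_⟩)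
  · have := S.conj_mem_N (c := (S.frame.e h)⁻¹) (S.commute_e_regElt h).inv_left (S.N.inv_mem hn)
    rwa [inv_inv] at this
  · rw [e_neg]
    group

/-- Two representatives of `ξ` in `K` differ by an element of `K ∩ P = M`, which commutes with `A`
and normalizes `N`; it leaves the `A`-component unchanged. -/
theorem isIwasawa_unique {g : S.G} {ξ : S.frame.Flag} {h h' : S.𝔞}
    (H : S.frame.IsIwasawa g ξ h) (H' : S.frame.IsIwasawa g ξ h') : h = h' := by
  obtain ⟨k, hk, hξ, k₁, hk₁, n, hn, he⟩ := H
  obtain ⟨k', hk', hξ', k₁', hk₁', n', hn', he'⟩ := H'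
  have hp : k⁻¹ * k' ∈ S.frame.P := (QuotientGroup.eq (s := S.frame.P)).1 (hξ.symm.trans hξ')
  have hm := S.mem_M_of_mem_K_of_mem_P (S.K.mul_mem (S.K.inv_mem hk) hk') hp
  set m := k⁻¹ * k' with hmdef
  have h1 : g * k' = (k₁ * m) * S.frame.e h * (m⁻¹ * n * m) := by
    have h2 : g * k' = g * k * m := by rw [hmdef]; group
    have h3 := (S.commute_of_mem_M hm h).eq
    rw [h2, he, mul_assoc k₁ m, h3]
    group
  exact S.eq_of_e_mul_eq (S.K.mul_mem hk₁ hm.1) hk₁'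
    (S.conj_mem_N (S.commute_regElt_of_mem_M hm) hn) hn' (h1.symm.trans he')

/-! ### The limit set is closed -/

/-- A diagonal argument: the flag space is first countable, and from a limit point close to `ξ` one
picks a single element whose simple roots all exceed `n`. -/
theorem isClosed_limitSet (Δ : Subgroup S.G) : IsClosed (S.limitSet Δ) := by
  have : FirstCountableTopology S.G := S.isInducing_mat.firstCountableTopology
  have : FirstCountableTopology S.frame.Flag :=
    inferInstanceAs (FirstCountableTopology (S.G ⧸ S.frame.P))
  refine isClosed_of_closure_subset fun ξ hξ => ?_
  obtain ⟨U, hU⟩ := (𝓝 ξ).exists_antitone_basis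
  have key : ∀ n : ℕ, ∃ (g k k' : S.G) (h : S.𝔞), g ∈ Δ ∧ (k ∈ S.K ∧ k' ∈ S.K ∧
      h ∈ S.closedChamber ∧ g = k * S.frame.e h * k') ∧
      (∀ α, S.IsSimpleRoot α → (n : ℝ) ≤ α h) ∧ S.frame.flagMk k ∈ U n := by
    intro n
    obtain ⟨η, hηU, g, hg, k, k', h, hdec, hα, hk⟩ :=
      mem_closure_iff_nhds.1 hξ _ (interior_mem_nhds.2 (hU.1.mem_of_mem (i := n) trivial))
    -- Finiteness allows one index to serve all simple roots at once.
    have hfin : {α | S.IsSimpleRoot α}.Finite := S.finite_isRoot.subset fun α hα => hα.1.1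
    have h1 : ∀ᶠ i in atTop, ∀ α ∈ {α | S.IsSimpleRoot α}, (n : ℝ) ≤ α (h i) :=
      (eventually_all_finite hfin).2 fun α hs => (hα α hs).eventually_ge_atTop _
    have h2 : ∀ᶠ i in atTop, S.frame.flagMk (k i) ∈ U n :=
      (hk.eventually_mem (isOpen_interior.mem_nhds hηU)).mono fun i hi => interior_subset hi
    obtain ⟨i, hi1, hi2⟩ := (h1.and h2).exists
    exact ⟨g i, k i, k' i, h i, hg i, hdec i, hi1, hi2⟩
  choose g k k' h hg hdec hα hk using key
  exact ⟨g, hg, k, k', h, hdec,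
    fun α hs => tendsto_atTop_mono (fun n => hα n α hs) tendsto_natCast_atTop_atTop,
    hU.tendsto hk⟩

end SemisimpleGroup

/-! ### Transport of quasi-invariance along an embedding -/

section MeasureTransport

variable {X Y : Type*} [MeasurableSpace X] [MeasurableSpace Y] {Λ : Set X} {j : Λ → Y} {q : Y → X}
  {a : X → X} {A : Y → Y}

theorem map_graph_eq_withDensity (hΛ : MeasurableSet Λ) (hj : MeasurableEmbedding j)
    (ha : Measurable a) (hA : Measurable A) (hqj : ∀ ξ, q (j ξ) = ξ)
    (haA : ∀ (ξ : Λ) (h : a ξ ∈ Λ), A (j ξ) = j ⟨a ξ, h⟩) {ν : Measure Λ} {c : X → ℝ≥0∞}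
    (h : (ν.map Subtype.val).map a = (ν.map Subtype.val).withDensity c) :
    (ν.map j).map A = (ν.map j).withDensity (fun y => c (q y)) := by
  have hval := MeasurableEmbedding.subtype_coe hΛ
  -- Invariance of `Λ` under `a` is not needed: the pushforward has a density with respect to a
  -- measure carried by `Λ`, so almost every point stays in `Λ`.
  have hae : ∀ᵐ ξ : Λ ∂ν, a ξ ∈ Λ := by
    have h1 : (ν.map Subtype.val) Λᶜ = 0 := by
      rw [Measure.map_apply measurable_subtype_coe hΛ.compl]
      simp
    have h2 : ((ν.map Subtype.val).map a) Λᶜ = 0 := by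
      rw [h]
      exact withDensity_absolutelyContinuous _ _ h1
    rw [Measure.map_apply ha hΛ.compl, Measure.map_apply measurable_subtype_coe
      (ha hΛ.compl)] at h2
    exact h2
  ext C hC
  -- The trace of `C` on the image of `j` comes from a measurable `B ⊆ X`, to which the equation on
  -- `X` applies.
  obtain ⟨B, hB, hBC⟩ := hj.measurable hC
  have hval' : ∀ ξ : Λ, (ξ : X) ∈ B ↔ j ξ ∈ C := fun ξ => by
    change ξ ∈ Subtype.val ⁻¹' B ↔ ξ ∈ j ⁻¹' C
    rw [hBC]
  have h1 : ν (j ⁻¹' (A ⁻¹' C)) = ν (Subtype.val ⁻¹' (a ⁻¹' B)) := by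
    refine measure_congr ?_
    filter_upwards [hae] with ξ hξ
    refine propext ?_
    change A (j ξ) ∈ C ↔ a ξ ∈ B
    rw [haA ξ hξ, ← hval']
  rw [Measure.map_apply hA hC, hj.map_apply, h1, ← hval.map_apply, ← Measure.map_apply ha hB, h,
    withDensity_apply _ hB, withDensity_apply _ hC, hval.restrict_map, hj.restrict_map,
    hval.lintegral_map, hj.lintegral_map, hBC]
  simp only [hqj]

/-- Here `q` intertwines the two maps everywhere, so testing the equation on the sets `q ⁻¹' B`
suffices. -/
theorem map_val_eq_withDensity (hΛ : MeasurableSet Λ) (hj : MeasurableEmbedding j)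
    (hq : Measurable q) (ha : Measurable a) (hA : Measurable A) (hqj : ∀ ξ, q (j ξ) = ξ)
    (hqA : ∀ y, q (A y) = a (q y)) {ν : Measure Λ} {c : X → ℝ≥0∞}
    (h : (ν.map j).map A = (ν.map j).withDensity (fun y => c (q y))) :
    (ν.map Subtype.val).map a = (ν.map Subtype.val).withDensity c := by
  have hval := MeasurableEmbedding.subtype_coe hΛ
  ext B hB
  have h1 : (Subtype.val ⁻¹' (a ⁻¹' B) : Set Λ) = j ⁻¹' (A ⁻¹' (q ⁻¹' B)) := by
    ext ξ
    simp [hqA, hqj]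
  have h2 : j ⁻¹' (q ⁻¹' B) = Subtype.val ⁻¹' B := by
    ext ξ
    simp [hqj]
  rw [Measure.map_apply ha hB, hval.map_apply, h1, ← hj.map_apply, ← Measure.map_apply hA (hq hB),
    h, withDensity_apply _ hB, withDensity_apply _ (hq hB), hval.restrict_map, hj.restrict_map,
    hval.lintegral_map, hj.lintegral_map, h2]
  simp only [hqj]

end MeasureTransport

/-! ### Topology of flag spaces and the product of two frames. -/

namespace Frame

section Topology

variable {G : Type*} [Group G] [TopologicalSpace G] [IsTopologicalGroup G]
  {𝔞 : Type*} [AddCommGroup 𝔞] (S : Frame G 𝔞)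

theorem isOpenQuotientMap_flagMk : IsOpenQuotientMap S.flagMk :=
  QuotientGroup.isOpenQuotientMap_mk (N := S.P)

theorem continuous_smul_flag (g : G) : Continuous fun ξ : S.Flag => g • ξ :=
  continuous_const_smul (T := G ⧸ S.P) g

theorem t2Space_flag (hP : IsClosed (S.P : Set G)) : T2Space S.Flag := by
  rw [t2Space_iff_of_isOpenQuotientMap S.isOpenQuotientMap_flagMk]
  have : {p : G × G | S.flagMk p.1 = S.flagMk p.2} = (fun p : G × G => p.1⁻¹ * p.2) ⁻¹' S.P := by
    ext p
    exact QuotientGroup.eq (s := S.P)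
  rw [this]
  exact hP.preimage (by fun_prop)

end Topology

section Prod

variable {G₁ G₂ : Type*} [Group G₁] [Group G₂] {𝔞₁ 𝔞₂ : Type*} [AddCommGroup 𝔞₁] [AddCommGroup 𝔞₂]
  (S₁ : Frame G₁ 𝔞₁) (S₂ : Frame G₂ 𝔞₂)

theorem snd_mem_P {p : G₁ × G₂} (hp : p ∈ (S₁.prod S₂).P) : p.2 ∈ S₂.P := by
  have : (S₁.prod S₂).P ≤ S₂.P.comap (MonoidHom.snd G₁ G₂) := by
    refine sup_le (sup_le ?_ ?_) ?_
    · rintro m ⟨hK, hc⟩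
      refine (le_sup_left.trans le_sup_left : S₂.M ≤ _) ⟨hK.2, ?_⟩
      rintro _ ⟨h, rfl⟩
      have := congrArg Prod.snd (hc ((S₁.prod S₂).e (0, h.toAdd)) ⟨_, rfl⟩)
      simpa [prod, e] using this
    · rintro _ ⟨h, rfl⟩
      exact (le_sup_right.trans le_sup_left : S₂.A ≤ _) ⟨_, rfl⟩
    · intro n hn
      exact (le_sup_right : S₂.N ≤ _) hn.2
  exact this hp

theorem coe_prod_P : ((S₁.prod S₂).P : Set (G₁ × G₂)) =
    Prod.fst ⁻¹' (S₁.P : Set G₁) ∩ Prod.snd ⁻¹' (S₂.P : Set G₂) := by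
  ext p
  refine ⟨fun hp => ⟨fst_mem_P S₁ S₂ hp, snd_mem_P S₁ S₂ hp⟩, fun hp => ?_⟩
  have := (S₁.prod S₂).P.mul_mem (inl_mem_P S₁ S₂ hp.1) (inr_mem_P S₁ S₂ hp.2)
  simpa using this

theorem flagFst_flagPair (ξ : S₁.Flag) (η : S₂.Flag) : flagFst S₁ S₂ (flagPair S₁ S₂ ξ η) = ξ := by
  obtain ⟨x, rfl⟩ := QuotientGroup.mk_surjective ξ
  obtain ⟨y, rfl⟩ := QuotientGroup.mk_surjective η
  rfl

theorem smul_flagPair (g : G₁ × G₂) (ξ : S₁.Flag) (η : S₂.Flag) :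
    g • flagPair S₁ S₂ ξ η = flagPair S₁ S₂ (g.1 • ξ) (g.2 • η) := by
  obtain ⟨x, rfl⟩ := QuotientGroup.mk_surjective ξ
  obtain ⟨y, rfl⟩ := QuotientGroup.mk_surjective η
  rfl

theorem flagFst_smul (g : G₁ × G₂) (x : (S₁.prod S₂).Flag) :
    flagFst S₁ S₂ (g • x) = g.1 • flagFst S₁ S₂ x := by
  obtain ⟨x, rfl⟩ := QuotientGroup.mk_surjective x
  rfl

variable {S₁ S₂}

theorem IsIwasawa.fst {g : G₁ × G₂} {x : (S₁.prod S₂).Flag} {h : 𝔞₁ × 𝔞₂}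
    (H : (S₁.prod S₂).IsIwasawa g x h) : S₁.IsIwasawa g.1 (flagFst S₁ S₂ x) h.1 := by
  obtain ⟨k, hk, rfl, k', hk', n, hn, he⟩ := H
  exact ⟨k.1, hk.1, rfl, k'.1, hk'.1, n.1, hn.1, congrArg Prod.fst he⟩

theorem IsIwasawa.pair {g : G₁ × G₂} {ξ : S₁.Flag} {η : S₂.Flag} {h₁ : 𝔞₁} {h₂ : 𝔞₂}
    (H₁ : S₁.IsIwasawa g.1 ξ h₁) (H₂ : S₂.IsIwasawa g.2 η h₂) :
    (S₁.prod S₂).IsIwasawa g (flagPair S₁ S₂ ξ η) (h₁, h₂) := by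
  obtain ⟨k, hk, rfl, k', hk', n, hn, he⟩ := H₁
  obtain ⟨l, hl, rfl, l', hl', m, hm, he'⟩ := H₂
  exact ⟨(k, l), ⟨hk, hl⟩, rfl, (k', l'), ⟨hk', hl'⟩, (n, m), ⟨hn, hm⟩, Prod.ext he he'⟩

/-- Both sides are choices made by `Classical.epsilon`. Existence makes each choice admissible, and
uniqueness in the first factor identifies them. -/
theorem iwasawa_prod_fst (hex₁ : ∀ g ξ, ∃ h, S₁.IsIwasawa g ξ h)
    (hex₂ : ∀ g ξ, ∃ h, S₂.IsIwasawa g ξ h)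
    (huniq : ∀ g ξ h h', S₁.IsIwasawa g ξ h → S₁.IsIwasawa g ξ h' → h = h')
    (g : G₁ × G₂) (x : (S₁.prod S₂).Flag) :
    ((S₁.prod S₂).iwasawa g x).1 = S₁.iwasawa g.1 (flagFst S₁ S₂ x) := by
  have hex : ∃ h, (S₁.prod S₂).IsIwasawa g x h := by
    obtain ⟨y, rfl⟩ := QuotientGroup.mk_surjective x
    obtain ⟨h₁, H₁⟩ := hex₁ g.1 (S₁.flagMk y.1)
    obtain ⟨h₂, H₂⟩ := hex₂ g.2 (S₂.flagMk y.2)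
    exact ⟨_, H₁.pair H₂⟩
  exact huniq _ _ _ _ (Classical.epsilon_spec hex).fst (Classical.epsilon_spec (hex₁ _ _))

theorem busemann_prod_fst (hex₁ : ∀ g ξ, ∃ h, S₁.IsIwasawa g ξ h)
    (hex₂ : ∀ g ξ, ∃ h, S₂.IsIwasawa g ξ h)
    (huniq : ∀ g ξ h h', S₁.IsIwasawa g ξ h → S₁.IsIwasawa g ξ h' → h = h')
    (x : (S₁.prod S₂).Flag) (o₁ : S₁.Sym) (o₂ : S₂.Sym) (g : G₁ × G₂) :
    ((S₁.prod S₂).busemann x (S₁.symPair S₂ o₁ o₂) (g • S₁.symPair S₂ o₁ o₂)).1 =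
      S₁.busemann (flagFst S₁ S₂ x) o₁ (g.1 • o₁) := by
  obtain ⟨y, rfl⟩ := QuotientGroup.mk_surjective o₁
  obtain ⟨z, rfl⟩ := QuotientGroup.mk_surjective o₂
  exact congrArg₂ (· - ·) (iwasawa_prod_fst hex₁ hex₂ huniq (y, z)⁻¹ x)
    (iwasawa_prod_fst hex₁ hex₂ huniq (g * (y, z))⁻¹ x)

section Topology

variable [TopologicalSpace G₁] [IsTopologicalGroup G₁] [TopologicalSpace G₂] [IsTopologicalGroup G₂]

theorem continuous_flagFst : Continuous (flagFst S₁ S₂) :=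
  (S₁.prod S₂).isOpenQuotientMap_flagMk.isQuotientMap.continuous_iff.2
    (S₁.isOpenQuotientMap_flagMk.continuous.comp continuous_fst)

theorem continuous_flagPair : Continuous fun p : S₁.Flag × S₂.Flag => flagPair S₁ S₂ p.1 p.2 :=
  (S₁.isOpenQuotientMap_flagMk.prodMap S₂.isOpenQuotientMap_flagMk).isQuotientMap.continuous_iff.2
    (S₁.prod S₂).isOpenQuotientMap_flagMk.continuous

/-- The projection is a continuous left inverse, which gives injectivity and the right topology. The
image is closed because it is the fixed set of the retraction `r`, defined over the closed preimage
of `Λ`, in a Hausdorff space. -/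
theorem isClosedEmbedding_graphMap (h₁ : IsClosed (S₁.P : Set G₁)) (h₂ : IsClosed (S₂.P : Set G₂))
    {Λ : Set S₁.Flag} (hΛ : IsClosed Λ) {f : Λ → S₂.Flag} (hf : Continuous f) :
    Topology.IsClosedEmbedding (graphMap S₁ S₂ f) := by
  have hcont : Continuous (graphMap S₁ S₂ f) :=
    continuous_flagPair.comp (continuous_subtype_val.prodMk hf)
  have hcomp : flagFst S₁ S₂ ∘ graphMap S₁ S₂ f = Subtype.val := by
    ext ξ
    exact flagFst_flagPair S₁ S₂ _ _
  have : T2Space (S₁.prod S₂).Flag := by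
    apply t2Space_flag
    rw [coe_prod_P]
    exact (h₁.preimage continuous_fst).inter (h₂.preimage continuous_snd)
  refine ⟨⟨Topology.IsInducing.of_comp hcont continuous_flagFst
    (hcomp ▸ Topology.IsInducing.subtypeVal), ?_⟩, ?_⟩
  · exact Function.Injective.of_comp (f := flagFst S₁ S₂) (hcomp ▸ Subtype.val_injective)
  · let Z : Set (S₁.prod S₂).Flag := flagFst S₁ S₂ ⁻¹' Λ
    have hZ : IsClosed Z := hΛ.preimage continuous_flagFst
    let r : Z → (S₁.prod S₂).Flag := fun z => graphMap S₁ S₂ f ⟨flagFst S₁ S₂ z, z.2⟩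
    have hr : Continuous r :=
      hcont.comp ((continuous_flagFst.comp continuous_subtype_val).subtype_mk _)
    have hrange : Set.range (graphMap S₁ S₂ f) = Subtype.val '' {z : Z | r z = z} := by
      ext x
      constructor
      · rintro ⟨ξ, rfl⟩
        have hξ : flagFst S₁ S₂ (graphMap S₁ S₂ f ξ) = ξ := congrFun hcomp ξ
        refine ⟨⟨graphMap S₁ S₂ f ξ, ?_⟩, ?_, rfl⟩
        · change flagFst S₁ S₂ (graphMap S₁ S₂ f ξ) ∈ Λ
          rw [hξ]
          exact ξ.2
        · exact congrArg (graphMap S₁ S₂ f) (Subtype.ext hξ)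
      · rintro ⟨z, hz, rfl⟩
        exact ⟨_, hz⟩
    rw [hrange]
    exact hZ.isClosedEmbedding_subtypeVal.isClosedMap _ (isClosed_eq hr continuous_subtype_val)

end Topology

end Prod

end Frame

/-! ### Conformal measures on the graph -/

section Conformal

variable {V₁ V₂ : Type*} [NormedAddCommGroup V₁] [InnerProductSpace ℝ V₁] [FiniteDimensional ℝ V₁]
  [NormedAddCommGroup V₂] [InnerProductSpace ℝ V₂] [FiniteDimensional ℝ V₂]
  {S₁ : SemisimpleGroup V₁} {S₂ : SemisimpleGroup V₂} {Γ : Subgroup S₁.G} {ρ : Γ →* S₂.G}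
  {f : S₁.limitSet Γ → S₂.frame.Flag}

theorem measurableEmbedding_graphMap (hf : Continuous f) :
    MeasurableEmbedding (S₁.frame.graphMap S₂.frame f) :=
  (Frame.isClosedEmbedding_graphMap S₁.isClosed_P S₂.isClosed_P (S₁.isClosed_limitSet Γ)
    hf).measurableEmbedding

theorem measurableSet_limitSet : MeasurableSet (S₁.limitSet Γ) :=
  (S₁.isClosed_limitSet Γ).measurableSet

theorem busemann_prod (x : (S₁.frame.prod S₂.frame).Flag) (o₁ : S₁.frame.Sym) (o₂ : S₂.frame.Sym)
    (g : S₁.G × S₂.G) :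
    ((S₁.frame.prod S₂.frame).busemann x (S₁.frame.symPair S₂.frame o₁ o₂)
      (g • S₁.frame.symPair S₂.frame o₁ o₂)).1 =
      S₁.frame.busemann (S₁.frame.flagFst S₂.frame x) o₁ (g.1 • o₁) :=
  Frame.busemann_prod_fst S₁.exists_isIwasawa S₂.exists_isIwasawa
    (fun _ _ _ _ => S₁.isIwasawa_unique) x o₁ o₂ g

theorem isProbabilityMeasure_map_graphMap_iff (hf : Continuous f) (ν : Measure (S₁.limitSet Γ)) :
    IsProbabilityMeasure (ν.map (S₁.frame.graphMap S₂.frame f)) ↔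
      IsProbabilityMeasure (ν.map Subtype.val) := by
  rw [Measure.isProbabilityMeasure_map_iff (measurableEmbedding_graphMap hf).measurable.aemeasurable,
    Measure.isProbabilityMeasure_map_iff measurable_subtype_coe.aemeasurable]

/-- The graph map identifies the `Γ`-conformal measures on the limit set with the
`Γ_ρ`-conformal measures on the graph. -/
theorem isConformal_map_graphMap_iff (hf : Continuous f)
    (hfρ : ∀ (γ : Γ) (ξ η : S₁.limitSet Γ),
      (η : S₁.frame.Flag) = (γ : S₁.G) • (ξ : S₁.frame.Flag) → f η = ρ γ • f ξ)
    (o₁ : S₁.frame.Sym) (o₂ : S₂.frame.Sym) (ψ₁ : Module.Dual ℝ S₁.𝔞)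
    (ν : Measure (S₁.limitSet Γ)) :
    (S₁.frame.prod S₂.frame).IsConformal (selfJoining ρ)
        (ψ₁ ∘ₗ LinearMap.fst ℝ S₁.𝔞 S₂.𝔞) (S₁.frame.symPair S₂.frame o₁ o₂)
        (ν.map (S₁.frame.graphMap S₂.frame f)) ↔
      S₁.frame.IsConformal Γ ψ₁ o₁ (ν.map Subtype.val) := by
  have hj := measurableEmbedding_graphMap hf
  have hq : Measurable (S₁.frame.flagFst S₂.frame) := Frame.continuous_flagFst.measurable
  have hqj : ∀ ξ, S₁.frame.flagFst S₂.frame (S₁.frame.graphMap S₂.frame f ξ) = ξ :=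
    fun ξ => Frame.flagFst_flagPair _ _ _ _
  -- The form sees only the `𝔞₁`-component, so the density factors through the projection to the
  -- first flag space.
  have hb : ∀ g : S₁.G × S₂.G, (fun x : (S₁.frame.prod S₂.frame).Flag =>
      ENNReal.ofReal (Real.exp ((ψ₁ ∘ₗ LinearMap.fst ℝ S₁.𝔞 S₂.𝔞)
        ((S₁.frame.prod S₂.frame).busemann x (S₁.frame.symPair S₂.frame o₁ o₂)
          (g • S₁.frame.symPair S₂.frame o₁ o₂))))) =
      fun x => (fun ξ => ENNReal.ofReal (Real.exp (ψ₁ (S₁.frame.busemann ξ o₁ (g.1 • o₁)))))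
        (S₁.frame.flagFst S₂.frame x) := by
    intro g
    ext x
    rw [LinearMap.comp_apply, LinearMap.fst_apply, busemann_prod]
  constructor
  · rintro ⟨hp, hm⟩
    refine ⟨(isProbabilityMeasure_map_graphMap_iff hf ν).1 hp, fun g hg => ?_⟩
    have h := hm (g, ρ ⟨g, hg⟩) ⟨⟨g, hg⟩, rfl⟩
    rw [hb] at h
    exact map_val_eq_withDensity measurableSet_limitSet hj hq
      (S₁.frame.continuous_smul_flag g).measurable
      ((S₁.frame.prod S₂.frame).continuous_smul_flag _).measurable hqj
      (fun y => Frame.flagFst_smul _ _ _ _) h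
  · rintro ⟨hp, hm⟩
    refine ⟨(isProbabilityMeasure_map_graphMap_iff hf ν).2 hp, ?_⟩
    rintro _ ⟨γ, rfl⟩
    have hγ : Γ.subtype.prod ρ γ = ((γ : S₁.G), ρ γ) := rfl
    rw [hγ, hb]
    have haA : ∀ (ξ : S₁.limitSet Γ) (h : (γ : S₁.G) • (ξ : S₁.frame.Flag) ∈ S₁.limitSet Γ),
        ((γ : S₁.G), ρ γ) • S₁.frame.graphMap S₂.frame f ξ =
          S₁.frame.graphMap S₂.frame f ⟨(γ : S₁.G) • (ξ : S₁.frame.Flag), h⟩ := by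
      intro ξ hξ
      rw [Frame.graphMap, Frame.graphMap, Frame.smul_flagPair, hfρ γ ξ ⟨_, hξ⟩ rfl]
    exact map_graph_eq_withDensity (j := S₁.frame.graphMap S₂.frame f)
      (q := S₁.frame.flagFst S₂.frame) (a := fun ξ : S₁.frame.Flag => (γ : S₁.G) • ξ)
      (A := fun x : (S₁.frame.prod S₂.frame).Flag => ((γ : S₁.G), ρ γ) • x)
      (c := fun ξ => ENNReal.ofReal (Real.exp (ψ₁ (S₁.frame.busemann ξ o₁ ((γ : S₁.G) • o₁)))))
      measurableSet_limitSet hj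
      (S₁.frame.continuous_smul_flag (γ : S₁.G)).measurable
      ((S₁.frame.prod S₂.frame).continuous_smul_flag _).measurable hqj haA (hm γ γ.2)

theorem eq_map_comap_graphMap (hf : Continuous f) {μ : Measure (S₁.frame.prod S₂.frame).Flag}
    (hμ : μ (Set.range (S₁.frame.graphMap S₂.frame f))ᶜ = 0) :
    μ = (μ.comap (S₁.frame.graphMap S₂.frame f)).map (S₁.frame.graphMap S₂.frame f) := by
  rw [(measurableEmbedding_graphMap hf).map_comap, Measure.restrict_eq_self_of_ae_mem]
  exact hμ

theorem map_flagFst_map_graphMap (hf : Continuous f) (ν : Measure (S₁.limitSet Γ)) :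
    (ν.map (S₁.frame.graphMap S₂.frame f)).map (S₁.frame.flagFst S₂.frame) =
      ν.map Subtype.val := by
  rw [Measure.map_map Frame.continuous_flagFst.measurable
    (measurableEmbedding_graphMap hf).measurable]
  congr 1
  ext ξ
  exact Frame.flagFst_flagPair _ _ _ _

theorem map_graphMap_compl_range (hf : Continuous f) (ν : Measure (S₁.limitSet Γ)) :
    ν.map (S₁.frame.graphMap S₂.frame f) (Set.range (S₁.frame.graphMap S₂.frame f))ᶜ = 0 := by
  rw [(measurableEmbedding_graphMap hf).map_apply]
  simp

end Conformal

end SelfJoining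

end

theorem proposition4p3
    {V₁ V₂ : Type*}
    [NormedAddCommGroup V₁] [InnerProductSpace ℝ V₁] [FiniteDimensional ℝ V₁]
    [NormedAddCommGroup V₂] [InnerProductSpace ℝ V₂] [FiniteDimensional ℝ V₂]
    (S₁ : SelfJoining.SemisimpleGroup V₁) (S₂ : SelfJoining.SemisimpleGroup V₂)
    -- a Zariski dense discrete subgroup and a discrete faithful Zariski dense representation
    (Γ : Subgroup S₁.G) (hΓ : DiscreteTopology Γ) (hΓZ : S₁.IsZariskiDense Γ)
    (ρ : Γ →* S₂.G) (hρinj : Function.Injective ρ) (hρ : DiscreteTopology ρ.range)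
    (hρZ : S₂.IsZariskiDense ρ.range)
    -- a continuous equivariant map on the limit set
    (f : S₁.limitSet Γ → S₂.frame.Flag) (hf : Continuous f)
    (hfρ : ∀ (γ : Γ) (ξ η : S₁.limitSet Γ),
      (η : S₁.frame.Flag) = (γ : S₁.G) • (ξ : S₁.frame.Flag) → f η = ρ γ • f ξ)
    (o₁ : S₁.frame.Sym) (o₂ : S₂.frame.Sym) :
    -- the pushforward of a conformal measure on the limit set under `id × f` is conformal
    (∀ (ψ₁ : Module.Dual ℝ S₁.𝔞) (ν : MeasureTheory.Measure (S₁.limitSet Γ)),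
      S₁.frame.IsConformal Γ ψ₁ o₁ (ν.map Subtype.val) →
        (S₁.frame.prod S₂.frame).IsConformal (SelfJoining.selfJoining ρ)
            (ψ₁ ∘ₗ LinearMap.fst ℝ S₁.𝔞 S₂.𝔞) (S₁.frame.symPair S₂.frame o₁ o₂)
            (ν.map (S₁.frame.graphMap S₂.frame f)) ∧
          ν.map (S₁.frame.graphMap S₂.frame f)
            (Set.range (S₁.frame.graphMap S₂.frame f))ᶜ = 0) ∧
    -- conversely, every such measure on `Λ_ρ = (id × f)(Λ)` is the pushforward of a conformal
    -- measure on the limit set, namely of its image under the first projection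
    (∀ (ψ₁ : Module.Dual ℝ S₁.𝔞)
        (μ : MeasureTheory.Measure (S₁.frame.prod S₂.frame).Flag),
      (S₁.frame.prod S₂.frame).IsConformal (SelfJoining.selfJoining ρ)
          (ψ₁ ∘ₗ LinearMap.fst ℝ S₁.𝔞 S₂.𝔞) (S₁.frame.symPair S₂.frame o₁ o₂) μ →
      μ (Set.range (S₁.frame.graphMap S₂.frame f))ᶜ = 0 →
        ∃ ν : MeasureTheory.Measure (S₁.limitSet Γ),
          S₁.frame.IsConformal Γ ψ₁ o₁ (ν.map Subtype.val) ∧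
          ν.map Subtype.val = μ.map (S₁.frame.flagFst S₂.frame) ∧
          μ = ν.map (S₁.frame.graphMap S₂.frame f)) ∧
    -- the conformal measures on `Λ_ρ` with a linear form that factors through `𝔞₁` are exactly the
    -- graph-conformal measures
    (∀ μ : MeasureTheory.Measure (S₁.frame.prod S₂.frame).Flag,
      (μ (Set.range (S₁.frame.graphMap S₂.frame f))ᶜ = 0 ∧
        ∃ σ : Module.Dual ℝ (S₁.𝔞 × S₂.𝔞),
          (∃ ψ₁ : Module.Dual ℝ S₁.𝔞, σ = ψ₁ ∘ₗ LinearMap.fst ℝ S₁.𝔞 S₂.𝔞) ∧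
          (S₁.frame.prod S₂.frame).IsConformal (SelfJoining.selfJoining ρ) σ
            (S₁.frame.symPair S₂.frame o₁ o₂) μ) ↔
      ∃ ν : MeasureTheory.Measure (S₁.limitSet Γ),
        (∃ ψ₁ : Module.Dual ℝ S₁.𝔞, S₁.frame.IsConformal Γ ψ₁ o₁ (ν.map Subtype.val)) ∧
          μ = ν.map (S₁.frame.graphMap S₂.frame f)) := by
  have hiff := SelfJoining.isConformal_map_graphMap_iff hf hfρ o₁ o₂
  refine ⟨fun ψ₁ ν hν => ⟨(hiff ψ₁ ν).2 hν, SelfJoining.map_graphMap_compl_range hf ν⟩,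
    fun ψ₁ μ hμ hrange => ?_, fun μ => ⟨?_, ?_⟩⟩
  · have hμν := SelfJoining.eq_map_comap_graphMap hf hrange
    -- The witness is the pullback of `μ` along the graph map; its image in the first flag space is
    -- the projection of `μ`.
    refine ⟨_, (hiff ψ₁ _).1 (hμν ▸ hμ), ?_, hμν⟩
    rw [← SelfJoining.map_flagFst_map_graphMap hf, ← hμν]
  · rintro ⟨hrange, _, ⟨ψ₁, rfl⟩, hμ⟩
    have hμν := SelfJoining.eq_map_comap_graphMap hf hrange
    exact ⟨_, ⟨ψ₁, (hiff ψ₁ _).1 (hμν ▸ hμ)⟩, hμν⟩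
  · rintro ⟨ν, ⟨ψ₁, hν⟩, rfl⟩
    exact ⟨SelfJoining.map_graphMap_compl_range hf ν, _, ⟨ψ₁, rfl⟩, (hiff ψ₁ ν).2 hν⟩
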